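/- For a subset $U$ with dense interior of a real locally convex space $E$, and a real locally convex space $F$, call $f\colon U\to F$ of class $C^0$ if it is continuous, and, inductively, of class $C^{k+1}$ if it is continuous, the limit $df(x,v)=\lim_{h\to 0}\frac{f(x+hv)-f(x)}{h}$ exists for all $x\in\operatorname{int}(U)$ and $v\in E$, and $df\colon \operatorname{int}(U)\times E\to F$ extends to a continuous map $U\times E\to F$ (again written $df$) that is of class $C^k$ on $U\times E\subseteq E\times E$. The map $f$ is smooth, $f\in C^\infty(U,F)$, if it is of class $C^k$ for every $k\ge 0$. (For open $U$ this is the usual notion of a smooth map between locally convex spaces.) **Theorem.** Let $F$ be a Fréchet space, i.e. a complete metrizable locally convex space, let $n\ge 0$, and let $f\in C^\infty([0,1]^n,F)$. Then there exists $\bar f\in C^\infty(\mathbb{R}^n,F)$ with $\bar f|_{[0,1]^n}=f$. -/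

import Mathlib

open Set Filter Topology

section SmoothCalculus

universe u v

/-- `df` is the differential on `U × E` of the map `f : U → F`, where `U` is a subset of `E` with
dense interior: on `int U × E` it is the directional derivative
`df (x, v) = lim_{h → 0} (f (x + h v) - f x) / h`, and it is continuous on all of `U × E`.
Maps on `U` are represented by total functions; only their values on `U` are used.
Since `int U × E` is dense in `U × E`, for Hausdorff `F` the values of `df` on `U × E` are
determined by `f`. -/
def IsDifferentialOn {E : Type u} {F : Type v} [AddCommGroup E] [Module ℝ E] [TopologicalSpace E]
    [AddCommGroup F] [Module ℝ F] [TopologicalSpace F]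
    (U : Set E) (f : E → F) (df : E × E → F) : Prop :=
  (∀ x ∈ interior U, ∀ v : E,
    Tendsto (fun h : ℝ => h⁻¹ • (f (x + h • v) - f x)) (𝓝[≠] 0) (𝓝 (df (x, v)))) ∧
  ContinuousOn df (U ×ˢ (univ : Set E))

/-- `f : U → F` is `C^k`, for `U` a subset of `E` with dense interior: it is `C^0` if it is
continuous, and it is `C^(k+1)` if it is continuous, has a differential `df` on `U × E`
(in the sense of `IsDifferentialOn`), and `df : U × E → F` is `C^k`.
For open `U` this is the usual (Michal–Bastiani) notion of a `C^k` map. -/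
def IsCkOn {F : Type v} [AddCommGroup F] [Module ℝ F] [TopologicalSpace F] :
    ℕ → ∀ {E : Type u} [AddCommGroup E] [Module ℝ E] [TopologicalSpace E],
      Set E → (E → F) → Prop
  | 0, _, _, _, _, U, f => ContinuousOn f U
  | k + 1, E, _, _, _, U, f => ContinuousOn f U ∧
      ∃ df : E × E → F, IsDifferentialOn U f df ∧ IsCkOn k (U ×ˢ (univ : Set E)) df

/-- `f : U → F` is smooth if it is `C^k` for every `k`. -/
def IsSmoothOn {E : Type u} {F : Type v} [AddCommGroup E] [Module ℝ E] [TopologicalSpace E]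
    [AddCommGroup F] [Module ℝ F] [TopologicalSpace F] (U : Set E) (f : E → F) : Prop :=
  ∀ k : ℕ, IsCkOn k U f

end SmoothCalculus

/-! The extension is Seeley's reflection, applied one coordinate at a time. For a map given on `x i
≥ 0`, put `∑ k, a k • f (…, -2 ^ k * x i, …)` on `x i < 0`, with weights satisfying `∑ k, a k * (-2
^ k) ^ m = 1` absolutely for every `m`. The `m`-th normal derivative of the reflection carries the
weights `a k * (-2 ^ k) ^ m`, so all derivatives match at the hyperplane
(`hasSum_seeleyCoeff_mul_neg_two_pow_pow`). If `f` vanishes for `x i ≥ 1`, the sum is locally finite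
off the hyperplane; on it all terms are multiples of one value.

To reach this situation, a cutoff in each coordinate splits `f` on the cube into pieces which, up to
flipping coordinates, vanish near the faces opposite to the origin (`IsSmoothOn.exists_extension`).
Such a piece extends by zero to the orthant, and the reflections remove its walls one by one
(`IsPartialFamily.exists_extension`).

Smoothness is tracked by a tree of one-sided partial derivatives indexed by words
(`IsPartialFamily`), with no symmetry of mixed partials needed. The passage from the differential to
this tree and back, and the differentiability at the hyperplane, all rest on one mean value theorem
for closed convex sets, `slope_mem_of_hasDirDeriv`. -/

section DirectionalDerivative

/-! ### Directional derivatives within a set, and the mean value theorem. -/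

/-- The function `f` has directional derivative `c` at `x` in the direction `v` within `S`. -/
def HasDirDeriv {E F : Type*} [AddCommGroup E] [Module ℝ E] [AddCommGroup F] [Module ℝ F]
    [TopologicalSpace F] (S : Set E) (f : E → F) (x v : E) (c : F) : Prop :=
  Tendsto (fun h : ℝ => h⁻¹ • (f (x + h • v) - f x)) (𝓝[{h | h ≠ 0 ∧ x + h • v ∈ S}] 0) (𝓝 c)

variable {E E' F : Type*} [AddCommGroup E] [Module ℝ E] [AddCommGroup E'] [Module ℝ E']
  [AddCommGroup F] [Module ℝ F] [TopologicalSpace F]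

theorem hasDirDeriv_univ {f : E → F} {x v : E} {c : F} :
    HasDirDeriv univ f x v c ↔
      Tendsto (fun h : ℝ => h⁻¹ • (f (x + h • v) - f x)) (𝓝[≠] 0) (𝓝 c) := by
  have : {h : ℝ | h ≠ 0 ∧ x + h • v ∈ (univ : Set E)} = {0}ᶜ := by ext; simp
  rw [HasDirDeriv, this]

theorem HasDirDeriv.mono {S T : Set E} {f : E → F} {x v : E} {c : F}
    (hf : HasDirDeriv T f x v c) (hST : S ⊆ T) : HasDirDeriv S f x v c :=
  Tendsto.mono_left hf (nhdsWithin_mono _ fun _ hh => ⟨hh.1, hST hh.2⟩)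

/-- Only the intersection of `S` with the line near `x` matters. -/
theorem HasDirDeriv.of_eventually_mem {S T : Set E} {f : E → F} {x v : E} {c : F}
    (hf : HasDirDeriv T f x v c) (h : ∀ᶠ h : ℝ in 𝓝 0, x + h • v ∈ S → x + h • v ∈ T) :
    HasDirDeriv S f x v c := by
  refine Tendsto.mono_left hf ?_
  rw [nhdsWithin_le_iff, mem_nhdsWithin_iff_eventually]
  filter_upwards [h] with h hh hS using ⟨hS.1, hh hS.2⟩

theorem HasDirDeriv.congr {S : Set E} {f g : E → F} {x v : E} {c : F}
    (hf : HasDirDeriv S f x v c)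
    (h : ∀ᶠ h : ℝ in 𝓝 0, x + h • v ∈ S → g (x + h • v) = f (x + h • v))
    (hx : g x = f x) : HasDirDeriv S g x v c := by
  refine Tendsto.congr' ?_ hf
  rw [EventuallyEq, eventually_nhdsWithin_iff]
  filter_upwards [h] with h hh hS
  rw [hh hS.2, hx]

theorem HasDirDeriv.union {S T : Set E} {f : E → F} {x v : E} {c : F}
    (hS : HasDirDeriv S f x v c) (hT : HasDirDeriv T f x v c) : HasDirDeriv (S ∪ T) f x v c := by
  have : {h : ℝ | h ≠ 0 ∧ x + h • v ∈ S ∪ T} =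
      {h : ℝ | h ≠ 0 ∧ x + h • v ∈ S} ∪ {h : ℝ | h ≠ 0 ∧ x + h • v ∈ T} := by
    ext; simp only [mem_union, mem_ofPred_eq]; tauto
  rw [HasDirDeriv, this, nhdsWithin_union]
  exact Tendsto.sup hS hT

theorem hasDirDeriv_zero {S : Set E} {x v : E} : HasDirDeriv S (fun _ => (0 : F)) x v 0 := by
  simp [HasDirDeriv, tendsto_const_nhds]

theorem HasDirDeriv.add [ContinuousAdd F] {S : Set E} {f g : E → F} {x v : E} {c d : F}
    (hf : HasDirDeriv S f x v c) (hg : HasDirDeriv S g x v d) :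
    HasDirDeriv S (fun y => f y + g y) x v (c + d) := by
  refine (Tendsto.add hf hg).congr fun h => ?_
  rw [← smul_add, add_sub_add_comm]

theorem HasDirDeriv.sum [ContinuousAdd F] {ι : Type*} {S : Set E} {f : ι → E → F} {x v : E}
    {c : ι → F} (s : Finset ι) (hf : ∀ k ∈ s, HasDirDeriv S (f k) x v (c k)) :
    HasDirDeriv S (fun y => ∑ k ∈ s, f k y) x v (∑ k ∈ s, c k) := by
  classical
  induction s using Finset.induction_on with
  | empty => simpa using hasDirDeriv_zero
  | insert a s ha ih =>
    simp only [Finset.sum_insert ha]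
    exact (hf a (by simp)).add (ih fun k hk => hf k (by simp [hk]))

theorem HasDirDeriv.const_smul [ContinuousConstSMul ℝ F] {S : Set E} {f : E → F} {x v : E} {c : F}
    (a : ℝ) (hf : HasDirDeriv S f x v c) : HasDirDeriv S (fun y => a • f y) x v (a • c) := by
  refine (Tendsto.const_smul hf a).congr fun h => ?_
  rw [← smul_sub, smul_comm]

theorem HasDirDeriv.smul_direction [ContinuousConstSMul ℝ F] {S : Set E} {f : E → F} {x v : E}
    {c : F} {b : ℝ} (hb : b ≠ 0) (hf : HasDirDeriv S f x v c) :
    HasDirDeriv S f x (b • v) (b • c) := by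
  have h1 : Tendsto (fun h : ℝ => h * b) (𝓝[{h | h ≠ 0 ∧ x + h • b • v ∈ S}] 0)
      (𝓝[{h | h ≠ 0 ∧ x + h • v ∈ S}] 0) := by
    refine tendsto_nhdsWithin_of_tendsto_nhds_of_eventually_within _ ?_ ?_
    · refine Tendsto.mono_left ?_ nhdsWithin_le_nhds
      exact Continuous.tendsto' (by fun_prop) _ _ (by simp)
    · filter_upwards [self_mem_nhdsWithin] with h hh
      exact ⟨mul_ne_zero hh.1 hb, by simpa [mul_smul] using hh.2⟩
  refine ((Tendsto.const_smul (hf.comp h1) b)).congr fun h => ?_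
  simp only [Function.comp, smul_smul, mul_inv]
  rw [mul_left_comm, mul_inv_cancel₀ hb, mul_one]

theorem HasDirDeriv.comp_linear {S : Set E} {T : Set E'} {f : E' → F} {x v : E} {c : F}
    (L : E →ₗ[ℝ] E') (e : E') (hL : ∀ y ∈ S, L y + e ∈ T) (hf : HasDirDeriv T f (L x + e) (L v) c) :
    HasDirDeriv S (fun y => f (L y + e)) x v c := by
  have key : ∀ h : ℝ, L (x + h • v) + e = L x + e + h • L v := fun h => by
    simp only [map_add, map_smul]; abel
  refine (Tendsto.mono_left hf (nhdsWithin_mono _ ?_)).congr fun h => by simp only [key]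
  intro h hh
  exact ⟨hh.1, by rw [← key]; exact hL _ hh.2⟩

theorem HasDirDeriv.tendsto_along_line [IsTopologicalAddGroup F] [ContinuousSMul ℝ F]
    {f : E → F} {x v : E} {c : F} (hf : HasDirDeriv univ f x v c) :
    Tendsto (fun h : ℝ => f (x + h • v)) (𝓝[≠] 0) (𝓝 (f x)) := by
  have h1 := hasDirDeriv_univ.1 hf
  have h2 : Tendsto (fun h : ℝ => h) (𝓝[≠] 0) (𝓝 0) := nhdsWithin_le_nhds
  have h3 := (h2.smul h1).add_const (f x)
  rw [zero_smul, zero_add] at h3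
  refine h3.congr' ?_
  filter_upwards [self_mem_nhdsWithin] with h hh
  rw [smul_inv_smul₀ hh]; abel

/-- **Mean value theorem** in a locally convex space: a difference quotient lies in every closed
convex set containing the derivatives along the segment. -/
theorem slope_mem_of_hasDirDeriv [IsTopologicalAddGroup F] [ContinuousSMul ℝ F]
    [LocallyConvexSpace ℝ F] {f : E → F} {x v : E} {h : ℝ} (hh : h ≠ 0) {C : Set F}
    (hC : Convex ℝ C) (hC' : IsClosed C)
    (hcont : ContinuousOn (fun s : ℝ => f (x + (s * h) • v)) (Icc 0 1))
    (hf : ∀ s ∈ Ioo (0 : ℝ) 1, ∃ c ∈ C, HasDirDeriv univ f (x + (s * h) • v) v c) :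
    h⁻¹ • (f (x + h • v) - f x) ∈ C := by
  by_contra hmem
  -- Separate the quotient from `C` by a functional `ℓ`; the scalar mean value theorem for `ℓ ∘ f`
  -- on the segment contradicts the separation. The parameter `s * h` with `s ∈ [0, 1]` treats both
  -- signs of `h` at once.
  obtain ⟨ℓ, u, hu, hl⟩ := geometric_hahn_banach_point_closed hC hC' hmem
  choose! c hcC hc using hf
  have hder : ∀ s ∈ Ioo (0 : ℝ) 1,
      HasDerivAt (fun s : ℝ => ℓ (f (x + (s * h) • v))) (h * ℓ (c s)) s := by
    intro s hs
    rw [hasDerivAt_iff_tendsto_slope_zero]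
    have h1 := hasDirDeriv_univ.1 ((hc s hs).smul_direction hh)
    have h2 := (ℓ.continuous.tendsto _).comp h1
    rw [map_smul, smul_eq_mul] at h2
    refine h2.congr fun t => ?_
    simp only [Function.comp, map_smul, map_sub, smul_smul, add_mul, add_smul, add_assoc]
  obtain ⟨s, hs, hs'⟩ := exists_hasDerivAt_eq_slope (fun s : ℝ => ℓ (f (x + (s * h) • v))) _
    zero_lt_one (ℓ.continuous.comp_continuousOn hcont) hder
  have := hl _ (hcC s hs)
  simp only [one_mul, zero_mul, zero_smul, add_zero, sub_zero, div_one] at hs'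
  rw [map_smul, map_sub, ← hs', smul_eq_mul, inv_mul_cancel_left₀ hh] at hu
  exact lt_irrefl _ (hu.trans this)

theorem exists_closed_convex_nhds_subset [IsTopologicalAddGroup F] [ContinuousSMul ℝ F]
    [LocallyConvexSpace ℝ F] {y : F} {W : Set F} (hW : W ∈ 𝓝 y) :
    ∃ C ∈ 𝓝 y, Convex ℝ C ∧ IsClosed C ∧ C ⊆ W := by
  have h0 : (fun z => z + y) ⁻¹' W ∈ 𝓝 (0 : F) :=
    (continuous_id.add continuous_const).continuousAt.preimage_mem_nhds (by simpa using hW)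
  obtain ⟨C, hC, hCW⟩ := (nhds_hasBasis_absConvex_closed ℝ F).mem_iff.1 h0
  refine ⟨(fun z => z - y) ⁻¹' C, ?_, ?_, hC.2.1.preimage (by fun_prop), fun z hz => ?_⟩
  · exact (continuous_id.sub continuous_const).continuousAt.preimage_mem_nhds (by simpa using hC.1)
  · have := hC.2.2.2.translate_preimage_left (-y)
    simpa only [sub_eq_add_neg] using this
  · simpa using hCW hz

end DirectionalDerivative

/-! ### Calculus of `C^k` maps: uniqueness of the differential, affine substitution, products. -/

section SmoothMaps

universe u v

variable {E E' : Type u} {F : Type v}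
  [AddCommGroup E] [Module ℝ E] [TopologicalSpace E]
  [AddCommGroup E'] [Module ℝ E'] [TopologicalSpace E']
  [AddCommGroup F] [Module ℝ F] [TopologicalSpace F]

theorem eventually_add_smul_mem [IsTopologicalAddGroup E] [ContinuousSMul ℝ E] {S : Set E}
    {x : E} (hS : S ∈ 𝓝 x) (v : E) :
    ∀ᶠ h : ℝ in 𝓝 0, x + h • v ∈ S := by
  have : Tendsto (fun h : ℝ => x + h • v) (𝓝 0) (𝓝 x) :=
    Continuous.tendsto' (by fun_prop) _ _ (by simp)
  exact this hS

theorem IsDifferentialOn.hasDirDeriv {U : Set E} {f : E → F} {df : E × E → F}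
    (h : IsDifferentialOn U f df) {x : E} (hx : x ∈ interior U) (v : E) :
    HasDirDeriv univ f x v (df (x, v)) :=
  hasDirDeriv_univ.2 (h.1 x hx v)

theorem IsDifferentialOn.congr [IsTopologicalAddGroup E] [ContinuousSMul ℝ E] {U : Set E}
    {f g : E → F} {df : E × E → F} (h : IsDifferentialOn U f df) (hfg : EqOn g f U) :
    IsDifferentialOn U g df := by
  refine ⟨fun x hx v => ?_, h.2⟩
  have hU := mem_interior_iff_mem_nhds.1 hx
  refine hasDirDeriv_univ.1 ((h.hasDirDeriv hx v).congr ?_ (hfg (interior_subset hx)))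
  filter_upwards [eventually_add_smul_mem hU v] with t ht _ using hfg ht

theorem IsCkOn.continuousOn {k : ℕ} {U : Set E} {f : E → F} (h : IsCkOn k U f) :
    ContinuousOn f U := by
  cases k with
  | zero => exact h
  | succ k => exact h.1

theorem IsCkOn.congr [IsTopologicalAddGroup E] [ContinuousSMul ℝ E] {k : ℕ}
    {U : Set E} {f g : E → F} (h : IsCkOn k U f) (hfg : EqOn g f U) :
    IsCkOn k U g := by
  cases k with
  | zero => exact ContinuousOn.congr h hfg
  | succ k =>
    obtain ⟨hc, df, hdf, hk⟩ := h
    exact ⟨hc.congr hfg, df, hdf.congr hfg, hk⟩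

theorem IsCkOn.of_succ {k : ℕ} {E : Type u} [AddCommGroup E] [Module ℝ E] [TopologicalSpace E]
    {U : Set E} {f : E → F} (h : IsCkOn (k + 1) U f) : IsCkOn k U f := by
  induction k generalizing E with
  | zero => exact h.1
  | succ k ih =>
    obtain ⟨hc, df, hdf, hk⟩ := h
    exact ⟨hc, df, hdf, ih hk⟩

theorem IsSmoothOn.continuousOn {U : Set E} {f : E → F} (h : IsSmoothOn U f) :
    ContinuousOn f U := h 0

theorem IsDifferentialOn.eqOn [T2Space F] {U : Set E} (hU : U ⊆ closure (interior U))
    {f : E → F} {df df' : E × E → F} (h : IsDifferentialOn U f df)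
    (h' : IsDifferentialOn U f df') : EqOn df df' (U ×ˢ (univ : Set E)) := by
  have hint : EqOn df df' (interior U ×ˢ (univ : Set E)) := fun p hp =>
    tendsto_nhds_unique (h.1 p.1 hp.1 p.2) (h'.1 p.1 hp.1 p.2)
  refine hint.of_subset_closure h.2 h'.2 (prod_mono_left interior_subset) ?_
  rw [closure_prod_eq, closure_univ]
  exact prod_mono_left hU

/-- The definition allows a different differential for each `k`. Density of `interior U` in `U`
makes them agree on `U × E`, so a single one is `C^k` for all `k`. -/
theorem IsSmoothOn.exists_differential [IsTopologicalAddGroup E] [ContinuousSMul ℝ E] [T2Space F]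
    {U : Set E} (hU : U ⊆ closure (interior U)) {f : E → F} (h : IsSmoothOn U f) :
    ∃ df : E × E → F, IsDifferentialOn U f df ∧ IsSmoothOn (U ×ˢ (univ : Set E)) df := by
  obtain ⟨-, df, hdf, -⟩ := h 1
  refine ⟨df, hdf, fun k => ?_⟩
  obtain ⟨-, df', hdf', hk⟩ := h (k + 1)
  exact hk.congr (hdf.eqOn hU hdf')

theorem isCkOn_zero {k : ℕ} {E : Type u} [AddCommGroup E] [Module ℝ E] [TopologicalSpace E]
    {U : Set E} : IsCkOn k U (fun _ => (0 : F)) := by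
  induction k generalizing E with
  | zero => exact continuousOn_const
  | succ k ih =>
    refine ⟨continuousOn_const, fun _ => 0, ⟨fun x _ v => ?_, continuousOn_const⟩, ih⟩
    simp [tendsto_const_nhds]

theorem IsCkOn.add [ContinuousAdd F] {k : ℕ} {E : Type u} [AddCommGroup E] [Module ℝ E]
    [TopologicalSpace E] {U : Set E} {f g : E → F} (hf : IsCkOn k U f) (hg : IsCkOn k U g) :
    IsCkOn k U (fun x => f x + g x) := by
  induction k generalizing E with
  | zero => exact ContinuousOn.add hf hg
  | succ k ih =>
    obtain ⟨hf, df, hdf, hfk⟩ := hf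
    obtain ⟨hg, dg, hdg, hgk⟩ := hg
    refine ⟨hf.add hg, fun p => df p + dg p, ⟨fun x hx v => ?_, hdf.2.add hdg.2⟩, ih hfk hgk⟩
    have := (hdf.hasDirDeriv hx v).add (hdg.hasDirDeriv hx v)
    exact (hasDirDeriv_univ.1 this :)

theorem IsCkOn.sum [ContinuousAdd F] {ι : Type*} (s : Finset ι) {k : ℕ} {U : Set E}
    {f : ι → E → F} (hf : ∀ i ∈ s, IsCkOn k U (f i)) : IsCkOn k U (fun x => ∑ i ∈ s, f i x) := by
  classical
  induction s using Finset.induction_on with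
  | empty => simpa using isCkOn_zero
  | insert a s ha ih =>
    simp only [Finset.sum_insert ha]
    exact (hf a (by simp)).add (ih fun i hi => hf i (by simp [hi]))

theorem IsSmoothOn.add [ContinuousAdd F] {U : Set E} {f g : E → F} (hf : IsSmoothOn U f)
    (hg : IsSmoothOn U g) : IsSmoothOn U (fun x => f x + g x) := fun k => (hf k).add (hg k)

/-- The differential of the composite is `df` composed with the affine map `(x, v) ↦ (L x + e, L
v)`, so the induction closes. Interiors need their own hypothesis because `L` need not be open:
slices of a product occur later. -/
theorem IsCkOn.comp_affine {k : ℕ} {E E' : Type u}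
    [AddCommGroup E] [Module ℝ E] [TopologicalSpace E]
    [AddCommGroup E'] [Module ℝ E'] [TopologicalSpace E'] [IsTopologicalAddGroup E']
    {U : Set E} {U' : Set E'} {f : E' → F} (hf : IsCkOn k U' f) (L : E →L[ℝ] E') (e : E')
    (hL : ∀ x ∈ U, L x + e ∈ U') (hL' : ∀ x ∈ interior U, L x + e ∈ interior U') :
    IsCkOn k U (fun x => f (L x + e)) := by
  induction k generalizing E E' with
  | zero => exact ContinuousOn.comp hf (by fun_prop) hL
  | succ k ih =>
    obtain ⟨hf, df, hdf, hk⟩ := hf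
    have hcont : Continuous fun p : E × E => (L p.1 + e, L p.2) := by fun_prop
    refine ⟨hf.comp (by fun_prop) hL, fun p => df (L p.1 + e, L p.2),
      ⟨fun x hx v => ?_, hdf.2.comp hcont.continuousOn fun p hp => ⟨hL _ hp.1, mem_univ _⟩⟩, ?_⟩
    · have := HasDirDeriv.comp_linear (S := univ) (T := univ) (L : E →ₗ[ℝ] E') e
        (fun _ _ => mem_univ _) (hdf.hasDirDeriv (hL' x hx) (L v))
      exact (hasDirDeriv_univ.1 this :)
    · have := ih hk (L.prodMap L) (e, 0) (U := U ×ˢ univ) (fun p hp => ⟨hL _ hp.1, mem_univ _⟩)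
        (fun p hp => by
          rw [interior_prod_eq, interior_univ] at hp ⊢
          exact ⟨hL' _ hp.1, mem_univ _⟩)
      have heq : (fun p : E × E => df (L p.1 + e, L p.2)) =
          fun p => df (L.prodMap L p + (e, 0)) := by
        funext p
        simp [Prod.map]
      rwa [heq]

theorem IsSmoothOn.comp_affine [IsTopologicalAddGroup E'] {U : Set E} {U' : Set E'}
    {f : E' → F} (hf : IsSmoothOn U' f) (L : E →L[ℝ] E') (e : E') (hL : ∀ x ∈ U, L x + e ∈ U')
    (hL' : ∀ x ∈ interior U, L x + e ∈ interior U') : IsSmoothOn U (fun x => f (L x + e)) :=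
  fun k => (hf k).comp_affine L e hL hL'

theorem HasDirDeriv.smul_comp [IsTopologicalAddGroup F] [ContinuousSMul ℝ F] {f : E → F} {x v : E}
    {c : F} {φ : ℝ → ℝ} (l : E →L[ℝ] ℝ) (hφ : DifferentiableAt ℝ φ (l x))
    (hf : HasDirDeriv univ f x v c) :
    HasDirDeriv univ (fun y => φ (l y) • f y) x v
      (deriv φ (l x) • l v • f x + φ (l x) • c) := by
  have h1 : HasDerivAt (fun h : ℝ => φ (l x + h * l v)) (deriv φ (l x) * l v) 0 := by
    have h2 : HasDerivAt (fun h : ℝ => l x + h * l v) (l v) 0 := by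
      simpa using ((hasDerivAt_id (0 : ℝ)).mul_const (l v)).const_add (l x)
    have h3 : HasDerivAt φ (deriv φ (l x)) (l x + 0 * l v) := by simpa using hφ.hasDerivAt
    exact h3.comp 0 h2
  have h4 := h1.tendsto_slope_zero
  have h5 := hf.tendsto_along_line
  rw [hasDirDeriv_univ] at hf ⊢
  have h6 := (h4.smul h5).add (hf.const_smul (φ (l x)))
  rw [mul_smul] at h6
  refine h6.congr fun h => ?_
  simp only [zero_add, zero_mul, add_zero, map_add, map_smul, smul_eq_mul]
  rw [smul_comm (φ (l x)), mul_smul, ← smul_add, sub_smul, smul_sub]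
  congr 1
  exact sub_add_sub_cancel _ _ _

/-- The product rule gives `φ' (l x) • l v • f x + φ (l x) • df (x, v)`. Each term is again built
from scalar factors of the form "smooth function of a linear functional" and a `C^k` map, so this
restricted class of products is stable under differentiation. -/
theorem IsCkOn.smul_comp [IsTopologicalAddGroup F] [ContinuousSMul ℝ F] {k : ℕ} {E : Type u}
    [AddCommGroup E] [Module ℝ E] [TopologicalSpace E] [IsTopologicalAddGroup E]
    [ContinuousSMul ℝ E] {U : Set E} {f : E → F}
    (hf : IsCkOn k U f) {φ : ℝ → ℝ} (hφ : ContDiff ℝ (↑(⊤ : ℕ∞)) φ) (l : E →L[ℝ] ℝ) :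
    IsCkOn k U (fun x => φ (l x) • f x) := by
  induction k generalizing E φ with
  | zero => exact (hφ.continuous.comp l.continuous).continuousOn.smul hf
  | succ k ih =>
    have hlow := hf.of_succ
    obtain ⟨hf, df, hdf, hk⟩ := hf
    have hφ' : ContDiff ℝ (↑(⊤ : ℕ∞)) (deriv φ) := (contDiff_infty_iff_deriv.1 hφ).2
    have hfst : IsCkOn k (U ×ˢ (univ : Set E)) (fun p : E × E => f p.1) := by
      have := hlow.comp_affine (ContinuousLinearMap.fst ℝ E E) 0 (U := U ×ˢ univ)
        (fun p hp => by simpa using hp.1)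
        (fun p hp => by rw [interior_prod_eq] at hp; simpa using hp.1)
      simpa using this
    have hsum := (ih (ih hfst contDiff_id (l.comp (ContinuousLinearMap.snd ℝ E E))) hφ'
      (l.comp (ContinuousLinearMap.fst ℝ E E))).add
      (ih hk hφ (l.comp (ContinuousLinearMap.fst ℝ E E)))
    refine ⟨(hφ.continuous.comp l.continuous).continuousOn.smul hf, _,
      ⟨fun x hx v => ?_, hsum.continuousOn⟩, hsum⟩
    have := (hdf.hasDirDeriv hx v).smul_comp l (hφ.differentiable (by simp) _)
    exact (hasDirDeriv_univ.1 this :)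

theorem IsSmoothOn.smul_comp [IsTopologicalAddGroup E] [ContinuousSMul ℝ E]
    [IsTopologicalAddGroup F] [ContinuousSMul ℝ F] {U : Set E} {f : E → F}
    (hf : IsSmoothOn U f) {φ : ℝ → ℝ} (hφ : ContDiff ℝ (↑(⊤ : ℕ∞)) φ) (l : E →L[ℝ] ℝ) :
    IsSmoothOn U (fun x => φ (l x) • f x) := fun k => (hf k).smul_comp hφ l

end SmoothMaps

/-! ### Seeley's weights, from an entire function vanishing at the powers of two. -/

section SeeleySequence

/-- The Taylor coefficients of `∏ j, (1 - z / 2 ^ j)`. -/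
noncomputable def qExpCoeff : ℕ → ℝ
  | 0 => 1
  | k + 1 => -2 / (2 ^ (k + 1) - 1) * qExpCoeff k

theorem one_lt_two_pow_succ (k : ℕ) : (1 : ℝ) < 2 ^ (k + 1) :=
  one_lt_pow₀ one_lt_two (Nat.succ_ne_zero k)

theorem qExpCoeff_succ (k : ℕ) :
    2 ^ (k + 1) * qExpCoeff (k + 1) = qExpCoeff (k + 1) - 2 * qExpCoeff k := by
  have : (2 : ℝ) ^ (k + 1) - 1 ≠ 0 := (sub_pos.2 (one_lt_two_pow_succ k)).ne'
  rw [qExpCoeff]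
  field_simp
  ring

theorem qExpCoeff_ne_zero (k : ℕ) : qExpCoeff k ≠ 0 := by
  induction k with
  | zero => simp [qExpCoeff]
  | succ k ih =>
    have : (2 : ℝ) ^ (k + 1) - 1 ≠ 0 := (sub_pos.2 (one_lt_two_pow_succ k)).ne'
    rw [qExpCoeff]
    exact mul_ne_zero (div_ne_zero (by norm_num) this) ih

theorem summable_qExpCoeff_mul_pow (z : ℝ) : Summable fun k => qExpCoeff k * z ^ k := by
  rcases eq_or_ne z 0 with rfl | hz
  · refine summable_of_ne_finset_zero (s := {0}) fun k hk => ?_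
    simp [zero_pow (by simpa using hk : k ≠ 0)]
  refine summable_of_ratio_test_tendsto_lt_one (l := 0) one_pos
    (Eventually.of_forall fun k => mul_ne_zero (qExpCoeff_ne_zero k) (pow_ne_zero _ hz)) ?_
  have h1 : Tendsto (fun k : ℕ => (2 : ℝ) ^ (k + 1) - 1) atTop atTop :=
    tendsto_atTop_add_const_right _ _
      ((tendsto_pow_atTop_atTop_of_one_lt one_lt_two).comp (tendsto_add_atTop_nat 1))
  have h2 : Tendsto (fun k : ℕ => ‖-2 * z‖ / ((2 : ℝ) ^ (k + 1) - 1)) atTop (𝓝 0) :=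
    h1.const_div_atTop _
  refine h2.congr fun k => ?_
  have hk : (0 : ℝ) < 2 ^ (k + 1) - 1 := sub_pos.2 (one_lt_two_pow_succ k)
  have hq := qExpCoeff_ne_zero k
  rw [← norm_div, qExpCoeff, pow_succ z]
  rw [← Real.norm_of_nonneg hk.le, ← norm_div, Real.norm_of_nonneg hk.le]
  congr 1
  field_simp

/-- This is the functional equation `P (2 z) = (1 - 2 z) P z` of the product over `j ≥ 0`, read off
coefficientwise from the recursion. -/
theorem tsum_qExpCoeff_mul_two_mul_pow (z : ℝ) :
    ∑' k, qExpCoeff k * (2 * z) ^ k = (1 - 2 * z) * ∑' k, qExpCoeff k * z ^ k := by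
  have hs := summable_qExpCoeff_mul_pow z
  have h1 : ∀ k, qExpCoeff (k + 1) * (2 * z) ^ (k + 1) =
      qExpCoeff (k + 1) * z ^ (k + 1) - 2 * z * (qExpCoeff k * z ^ k) := fun k => by
    rw [mul_pow, ← mul_assoc, mul_comm (qExpCoeff (k + 1)), qExpCoeff_succ]
    ring
  rw [(summable_qExpCoeff_mul_pow (2 * z)).tsum_eq_zero_add, tsum_congr h1,
    ((summable_nat_add_iff 1).2 hs).tsum_sub (hs.mul_left _), tsum_mul_left]
  rw [hs.tsum_eq_zero_add]
  simp
  ring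

theorem tsum_qExpCoeff_mul_two_pow_pow (m : ℕ) :
    ∑' k, qExpCoeff k * ((2 : ℝ) ^ m) ^ k = 0 := by
  induction m with
  | zero =>
    -- At `z = 1 / 2` the factor `1 - 2 z` vanishes, giving the zero at `1`; doubling propagates it.
    have := tsum_qExpCoeff_mul_two_mul_pow (1 / 2)
    simpa using this
  | succ m ih =>
    rw [pow_succ', tsum_qExpCoeff_mul_two_mul_pow, ih, mul_zero]

/-- Unnormalised weights: `∑ k, seeleyPre k * z ^ k` changes sign from `2 ^ m` to `2 ^ (m + 1)`. -/
noncomputable def seeleyPre (k : ℕ) : ℝ := qExpCoeff k / (2 ^ k + 1)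

theorem abs_seeleyPre_le (k : ℕ) : |seeleyPre k| ≤ |qExpCoeff k| := by
  have : (1 : ℝ) ≤ 2 ^ k + 1 := by linarith [pow_pos (two_pos (α := ℝ)) k]
  rw [seeleyPre, abs_div, abs_of_pos (by linarith : (0 : ℝ) < 2 ^ k + 1)]
  exact div_le_self (abs_nonneg _) this

theorem summable_seeleyPre_mul_pow (z : ℝ) : Summable fun k => seeleyPre k * z ^ k := by
  refine (summable_qExpCoeff_mul_pow z).abs.of_norm_bounded fun k => ?_
  rw [Real.norm_eq_abs, abs_mul, abs_mul]
  exact mul_le_mul_of_nonneg_right (abs_seeleyPre_le k) (abs_nonneg _)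

/-- Dividing by `2 ^ k + 1` solves `S (2 z) + S z = P z`, and `P` vanishes at every `2 ^ m`. -/
theorem tsum_seeleyPre_mul_two_pow_pow_succ (m : ℕ) :
    ∑' k, seeleyPre k * ((2 : ℝ) ^ (m + 1)) ^ k = -∑' k, seeleyPre k * ((2 : ℝ) ^ m) ^ k := by
  rw [eq_neg_iff_add_eq_zero, ← (summable_seeleyPre_mul_pow _).tsum_add
    (summable_seeleyPre_mul_pow _), ← tsum_qExpCoeff_mul_two_pow_pow m]
  refine tsum_congr fun k => ?_
  have : (2 : ℝ) ^ k + 1 ≠ 0 := by positivity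
  rw [seeleyPre, pow_succ, mul_pow]
  field_simp

theorem abs_seeleyPre_succ_le (k : ℕ) :
    |seeleyPre (k + 4 + 1)| ≤ |seeleyPre (k + 4)| * (1 / 2) := by
  have h16 : (16 : ℝ) ≤ 2 ^ (k + 4) := by
    rw [pow_add]; linarith [one_le_pow₀ (one_le_two (α := ℝ)) (n := k)]
  have h1 : (0 : ℝ) < 2 ^ (k + 4 + 1) - 1 := sub_pos.2 (one_lt_two_pow_succ _)
  have h2 : |qExpCoeff (k + 4 + 1)| = 2 / (2 ^ (k + 4 + 1) - 1) * |qExpCoeff (k + 4)| := by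
    rw [qExpCoeff, abs_mul, abs_div, abs_of_pos h1]; norm_num
  have hq := abs_nonneg (qExpCoeff (k + 4))
  rw [seeleyPre, seeleyPre, abs_div, abs_div, h2,
    abs_of_pos (by positivity : (0 : ℝ) < 2 ^ (k + 4) + 1),
    abs_of_pos (by positivity : (0 : ℝ) < 2 ^ (k + 4 + 1) + 1)]
  rw [pow_succ (2 : ℝ) (k + 4)] at h1 ⊢
  set y : ℝ := 2 ^ (k + 4)
  rw [div_mul_eq_mul_div, div_div, div_mul_div_comm,
    div_le_div_iff₀ (by positivity) (by positivity)]
  nlinarith [mul_nonneg hq (by nlinarith : (0 : ℝ) ≤ (y * 2 - 1) * (y * 2 + 1) - 4 * (y + 1))]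

/-- Needed to normalise the weights. The first four terms sum to about `0.058`, while the geometric
tail is at most `32 / 5355 < 0.006`. -/
theorem tsum_seeleyPre_pos : 0 < ∑' k, seeleyPre k := by
  have hs : Summable seeleyPre := by simpa using summable_seeleyPre_mul_pow 1
  -- The constant `16 / 5355` is the exact value of `seeleyPre 4`.
  have hb : ∀ k, ‖seeleyPre (k + 4)‖ ≤ 16 / 5355 * (1 / 2) ^ k := by
    intro k
    induction k with
    | zero => norm_num [seeleyPre, qExpCoeff, abs_of_pos]
    | succ k ih =>
      rw [pow_succ, ← mul_assoc]
      have := abs_seeleyPre_succ_le k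
      rw [Real.norm_eq_abs] at ih ⊢
      rw [add_right_comm]
      linarith
  have hg : HasSum (fun k : ℕ => (16 / 5355 : ℝ) * (1 / 2) ^ k) (16 / 5355 * 2) :=
    hasSum_geometric_two.mul_left _
  have htail := tsum_of_norm_bounded hg hb
  rw [← hs.sum_add_tsum_nat_add 4]
  have h4 : ∑ k ∈ Finset.range 4, seeleyPre k = 1 / 2 - 2 / 3 + 4 / 15 - 8 / 189 := by
    norm_num [Finset.sum_range_succ, seeleyPre, qExpCoeff]
  rw [h4]
  have := (abs_le.1 (Real.norm_eq_abs _ ▸ htail)).1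
  linarith

/-- Seeley's weights. -/
noncomputable def seeleyCoeff (k : ℕ) : ℝ := seeleyPre k / ∑' k, seeleyPre k

theorem summable_seeleyCoeff_mul_neg_two_pow_pow (m : ℕ) :
    Summable fun k => seeleyCoeff k * (-2 ^ k) ^ m := by
  have := ((summable_seeleyPre_mul_pow (2 ^ m)).mul_left ((-1) ^ m)).div_const
    (∑' k, seeleyPre k)
  refine this.congr fun k => ?_
  rw [seeleyCoeff, neg_pow ((2 : ℝ) ^ k), ← pow_mul, ← pow_mul, mul_comm k m]
  ring

/-- All moments of Seeley's weights at the nodes `-2 ^ k` are equal to one. -/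
theorem hasSum_seeleyCoeff_mul_neg_two_pow_pow (m : ℕ) :
    HasSum (fun k => seeleyCoeff k * (-2 ^ k) ^ m) 1 := by
  -- The `m` sign changes cancel the sign of `(-2 ^ k) ^ m`.
  have hm : ∑' k, seeleyPre k * ((2 : ℝ) ^ m) ^ k = (-1) ^ m * ∑' k, seeleyPre k := by
    induction m with
    | zero => simp
    | succ m ih => rw [tsum_seeleyPre_mul_two_pow_pow_succ, ih]; ring
  have h1 := (((summable_seeleyPre_mul_pow (2 ^ m)).hasSum.mul_left ((-1) ^ m)).div_const
    (∑' k, seeleyPre k))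
  rw [hm, ← mul_assoc, ← mul_pow, neg_one_mul, neg_neg, one_pow, one_mul,
    div_self tsum_seeleyPre_pos.ne'] at h1
  refine h1.congr_fun fun k => ?_
  rw [seeleyCoeff, neg_pow ((2 : ℝ) ^ k), ← pow_mul, ← pow_mul, mul_comm k m]
  ring

end SeeleySequence

/-! ### Families of partial derivatives, and their equivalence with smoothness. -/

section PartialFamily

universe v

variable {F : Type v} [AddCommGroup F] [Module ℝ F] [TopologicalSpace F]

/-- On a convex set with nonempty interior, a continuous map with a differential has the
corresponding directional derivatives within the set at boundary points, too. -/
theorem IsDifferentialOn.hasDirDeriv_of_convex [IsTopologicalAddGroup F] [ContinuousSMul ℝ F]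
    [LocallyConvexSpace ℝ F] {E : Type*} [NormedAddCommGroup E] [NormedSpace ℝ E] {U : Set E}
    (hU : Convex ℝ U) (hne : (interior U).Nonempty) {f : E → F} {df : E × E → F}
    (hf : ContinuousOn f U) (hdf : IsDifferentialOn U f df) {x : E} (hx : x ∈ U) (v : E) :
    HasDirDeriv U f x v (df (x, v)) := by
  obtain ⟨c₀, hc₀⟩ := hne
  intro W hW
  obtain ⟨C, hC, hCc, hCcl, hCW⟩ := exists_closed_convex_nhds_subset hW
  have hcv : ContinuousWithinAt (fun y => df (y, v)) U x :=
    (hdf.2.comp (by fun_prop : Continuous fun y : E => (y, v)).continuousOn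
      fun y hy => ⟨hy, mem_univ _⟩) x hx
  obtain ⟨ε, hε, hball⟩ := Metric.mem_nhdsWithin_iff.1 (hcv hC)
  have hsmall := (nhdsWithin_le_nhds (s := {h : ℝ | h ≠ 0 ∧ x + h • v ∈ U}))
    (eventually_add_smul_mem (Metric.ball_mem_nhds x hε) v)
  rw [mem_map]
  filter_upwards [self_mem_nhdsWithin, hsmall] with h hh hhε
  refine hCW ?_
  -- Contract the segment from `x` to `x + h • v` towards the interior point `c₀`. It keeps its
  -- direction, its length shrinks by `1 - τ`, and it lies in the interior, where the mean value
  -- theorem applies; then let `τ → 0`.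
  set y : ℝ → E := fun τ => x + τ • (c₀ - x) with hy
  set z : ℝ → E := fun τ => y τ + ((1 - τ) * h) • v with hz
  have hz' : ∀ τ, z τ = (x + h • v) + τ • (c₀ - (x + h • v)) := fun τ => by
    simp only [hz, hy, sub_mul, one_mul, sub_smul, smul_sub, smul_add, mul_smul]; abel
  have hyc : Continuous y := by fun_prop
  have hzc : Continuous z := by fun_prop
  have hy0 : y 0 = x := by simp [hy]
  have hz0 : z 0 = x + h • v := by simp [hz']
  have hIoo : ∀ᶠ τ : ℝ in 𝓝[>] 0, τ ∈ Ioo (0 : ℝ) 1 := Ioo_mem_nhdsGT one_pos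
  have hyint : ∀ τ ∈ Ioo (0 : ℝ) 1, y τ ∈ interior U := fun τ hτ =>
    hU.add_smul_sub_mem_interior hx hc₀ ⟨hτ.1, hτ.2.le⟩
  have hzint : ∀ τ ∈ Ioo (0 : ℝ) 1, z τ ∈ interior U := fun τ hτ => by
    rw [hz']
    exact hU.add_smul_sub_mem_interior hh.2 hc₀ ⟨hτ.1, hτ.2.le⟩
  have hyball : ∀ᶠ τ : ℝ in 𝓝[>] 0, y τ ∈ Metric.ball x ε :=
    nhdsWithin_le_nhds (hyc.continuousAt.preimage_mem_nhds
      (Metric.isOpen_ball.mem_nhds (by simpa [hy0] using hε)))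
  have hzball : ∀ᶠ τ : ℝ in 𝓝[>] 0, z τ ∈ Metric.ball x ε :=
    nhdsWithin_le_nhds (hzc.continuousAt.preimage_mem_nhds
      (Metric.isOpen_ball.mem_nhds (by rw [hz0]; exact hhε)))
  have hmem : ∀ᶠ τ : ℝ in 𝓝[>] 0, ((1 - τ) * h)⁻¹ • (f (z τ) - f (y τ)) ∈ C := by
    filter_upwards [hIoo, hyball, hzball] with τ hτ hyb hzb
    have hseg : ∀ s ∈ Icc (0 : ℝ) 1, y τ + (s * ((1 - τ) * h)) • v ∈
        interior U ∩ Metric.ball x ε := by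
      intro s hs
      rw [mul_smul]
      exact (hU.interior.inter (convex_ball x ε)).add_smul_mem ⟨hyint τ hτ, hyb⟩
        ⟨hzint τ hτ, hzb⟩ hs
    refine slope_mem_of_hasDirDeriv (mul_ne_zero (sub_pos.2 hτ.2).ne' hh.1) hCc hCcl ?_ ?_
    · exact hf.comp (by fun_prop) fun s hs => interior_subset (hseg s hs).1
    · intro s hs
      have hs' := hseg s (Ioo_subset_Icc_self hs)
      exact ⟨_, hball ⟨hs'.2, interior_subset hs'.1⟩, hdf.hasDirDeriv hs'.1 v⟩
  have hfy : Tendsto (fun τ => f (y τ)) (𝓝[>] 0) (𝓝 (f x)) := by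
    have h1 : Tendsto y (𝓝[>] 0) (𝓝[U] x) :=
      tendsto_nhdsWithin_of_tendsto_nhds_of_eventually_within _
        (hy0 ▸ hyc.continuousAt.tendsto.mono_left nhdsWithin_le_nhds)
        (hIoo.mono fun τ hτ => interior_subset (hyint τ hτ))
    exact (hf x hx).tendsto.comp h1
  have hfz : Tendsto (fun τ => f (z τ)) (𝓝[>] 0) (𝓝 (f (x + h • v))) := by
    have h1 : Tendsto z (𝓝[>] 0) (𝓝[U] (x + h • v)) :=
      tendsto_nhdsWithin_of_tendsto_nhds_of_eventually_within _
        (hz0 ▸ hzc.continuousAt.tendsto.mono_left nhdsWithin_le_nhds)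
        (hIoo.mono fun τ hτ => interior_subset (hzint τ hτ))
    exact (hf _ hh.2).tendsto.comp h1
  have hc : Tendsto (fun τ : ℝ => ((1 - τ) * h)⁻¹) (𝓝[>] 0) (𝓝 h⁻¹) := by
    have h1 : ContinuousAt (fun τ : ℝ => ((1 - τ) * h)⁻¹) 0 :=
      ContinuousAt.inv₀ (by fun_prop) (by simpa using hh.1)
    simpa using h1.tendsto.mono_left nhdsWithin_le_nhds
  exact hCcl.mem_of_tendsto (hc.smul (hfz.sub hfy)) hmem

variable {n : ℕ}

/-- A family of maps indexed by words in the coordinates, such that prefixing the letter `i`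
to a word means taking the `i`-th partial derivative (within `S`). -/
structure IsPartialFamily (S : Set (Fin n → ℝ)) (D : List (Fin n) → (Fin n → ℝ) → F) : Prop where
  continuousOn : ∀ w, ContinuousOn (D w) S
  hasDirDeriv : ∀ w i, ∀ x ∈ S, HasDirDeriv S (D w) x (Pi.single i 1) (D (i :: w) x)

theorem IsSmoothOn.exists_partialFamily [IsTopologicalAddGroup F] [ContinuousSMul ℝ F]
    [LocallyConvexSpace ℝ F] [T2Space F] {S : Set (Fin n → ℝ)} (hS : Convex ℝ S)
    (hne : (interior S).Nonempty) {f : (Fin n → ℝ) → F} (hf : IsSmoothOn S f) :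
    ∃ D : List (Fin n) → (Fin n → ℝ) → F, D [] = f ∧ IsPartialFamily S D := by
  have hcl : S ⊆ closure (interior S) := by
    rw [hS.closure_interior_eq_closure_of_nonempty_interior hne]
    exact subset_closure
  have step : ∀ (g : {g : (Fin n → ℝ) → F // IsSmoothOn S g}) (i : Fin n),
      ∃ g' : {g : (Fin n → ℝ) → F // IsSmoothOn S g},
        ∀ x ∈ S, HasDirDeriv S g.1 x (Pi.single i 1) (g'.1 x) := by
    rintro ⟨g, hg⟩ i
    obtain ⟨dg, hdg, hsm⟩ := hg.exists_differential hcl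
    refine ⟨⟨fun x => dg (x, Pi.single i 1), ?_⟩, fun x hx =>
      hdg.hasDirDeriv_of_convex hS hne hg.continuousOn hx _⟩
    have := hsm.comp_affine (U := S)
      (ContinuousLinearMap.inl ℝ (Fin n → ℝ) (Fin n → ℝ)) (0, Pi.single i 1)
      (fun x hx => by simpa using hx)
      (fun x hx => by rw [interior_prod_eq]; simpa using hx)
    simpa using this
  choose d hd using step
  let D : List (Fin n) → {g : (Fin n → ℝ) → F // IsSmoothOn S g} := fun w =>
    List.rec ⟨f, hf⟩ (fun i _ g => d g i) w
  exact ⟨fun w => (D w).1, rfl, fun w => (D w).2.continuousOn, fun w i => hd (D w) i⟩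

/-- Allowing the base point `u h` to move is what lets increments in several coordinates be
telescoped in `IsPartialFamily.isDifferentialOn`. -/
theorem IsPartialFamily.tendsto_slope [IsTopologicalAddGroup F] [ContinuousSMul ℝ F]
    [LocallyConvexSpace ℝ F] {D : List (Fin n) → (Fin n → ℝ) → F} (hD : IsPartialFamily univ D)
    (w : List (Fin n)) (i : Fin n) (a : ℝ) {x : Fin n → ℝ} {u : ℝ → Fin n → ℝ}
    (hu : Tendsto u (𝓝[≠] 0) (𝓝 x)) :
    Tendsto (fun h : ℝ => h⁻¹ • (D w (u h + h • a • Pi.single i (1 : ℝ)) - D w (u h)))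
      (𝓝[≠] 0) (𝓝 (a • D (i :: w) x)) := by
  have hcont : ∀ w, Continuous (D w) := fun w => continuousOn_univ.1 (hD.continuousOn w)
  rcases eq_or_ne a 0 with rfl | ha
  · simp [tendsto_const_nhds]
  have key : Tendsto (fun h : ℝ =>
      (h * a)⁻¹ • (D w (u h + (h * a) • Pi.single i (1 : ℝ)) - D w (u h)))
      (𝓝[≠] 0) (𝓝 (D (i :: w) x)) := by
    intro W hW
    obtain ⟨C, hC, hCc, hCcl, hCW⟩ := exists_closed_convex_nhds_subset hW
    obtain ⟨ε, hε, hball⟩ := Metric.mem_nhds_iff.1 ((hcont (i :: w)).continuousAt hC)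
    have hid : Tendsto (fun h : ℝ => h) (𝓝[≠] 0) (𝓝 0) := nhdsWithin_le_nhds
    have hu' : Tendsto (fun h : ℝ => u h + (h * a) • Pi.single i (1 : ℝ)) (𝓝[≠] 0) (𝓝 x) := by
      simpa using hu.add ((hid.mul_const a).smul_const (Pi.single i (1 : ℝ) : Fin n → ℝ))
    rw [mem_map]
    filter_upwards [self_mem_nhdsWithin, hu (Metric.ball_mem_nhds x hε),
      hu' (Metric.ball_mem_nhds x hε)] with h hh h1 h2
    refine hCW (slope_mem_of_hasDirDeriv (mul_ne_zero hh ha) hCc hCcl ?_ ?_)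
    · exact ((hcont w).comp (by fun_prop)).continuousOn
    · intro s hs
      refine ⟨_, hball ?_, hD.hasDirDeriv w i _ (mem_univ _)⟩
      rw [mul_smul]
      exact (convex_ball x ε).add_smul_mem h1 h2 (Ioo_subset_Icc_self hs)
  refine (key.const_smul a).congr fun h => ?_
  rw [smul_smul, mul_inv, mul_left_comm, mul_inv_cancel₀ ha, mul_one, mul_smul]

theorem IsPartialFamily.isDifferentialOn [IsTopologicalAddGroup F] [ContinuousSMul ℝ F]
    [LocallyConvexSpace ℝ F] {D : List (Fin n) → (Fin n → ℝ) → F} (hD : IsPartialFamily univ D)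
    (w : List (Fin n)) :
    IsDifferentialOn univ (D w) (fun p => ∑ i, p.2 i • D (i :: w) p.1) := by
  have hcont : ∀ w, Continuous (D w) := fun w => continuousOn_univ.1 (hD.continuousOn w)
  refine ⟨fun x _ v => ?_, Continuous.continuousOn ?_⟩
  · have key : ∀ s : Finset (Fin n), Tendsto (fun h : ℝ => h⁻¹ •
        (D w (x + h • ∑ i ∈ s, v i • Pi.single i (1 : ℝ)) - D w x)) (𝓝[≠] 0)
        (𝓝 (∑ i ∈ s, v i • D (i :: w) x)) := by
      intro s
      induction s using Finset.induction_on with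
      | empty => simp [tendsto_const_nhds]
      | insert i s hi ih =>
        have hu : Tendsto (fun h : ℝ => x + h • ∑ i ∈ s, v i • (Pi.single i (1 : ℝ) : Fin n → ℝ))
            (𝓝[≠] 0) (𝓝 x) :=
          Tendsto.mono_left (Continuous.tendsto' (by fun_prop) _ _ (by simp)) nhdsWithin_le_nhds
        simp only [Finset.sum_insert hi]
        refine ((hD.tendsto_slope w i (v i) hu).add ih).congr fun h => ?_
        rw [← smul_add, sub_add_sub_cancel, smul_add, add_comm (h • v i • _), add_assoc]
    have hv : v = ∑ i, v i • Pi.single i (1 : ℝ) := pi_eq_sum_univ' v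
    have := key Finset.univ
    rwa [← hv] at this
  · exact continuous_finsetSum _ fun i _ => ((continuous_apply i).comp continuous_snd).smul
      ((hcont _).comp continuous_fst)

/-- The differential `∑ i, v i • D (i :: w) x` is a sum of coordinates of `v` times members of the
same family, so induction on `k` over all words closes. -/
theorem IsPartialFamily.isSmoothOn [IsTopologicalAddGroup F] [ContinuousSMul ℝ F]
    [LocallyConvexSpace ℝ F] {D : List (Fin n) → (Fin n → ℝ) → F} (hD : IsPartialFamily univ D)
    (w : List (Fin n)) : IsSmoothOn univ (D w) := by
  intro k
  induction k generalizing w with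
  | zero => exact hD.continuousOn w
  | succ k ih =>
    refine ⟨hD.continuousOn w, _, hD.isDifferentialOn w, IsCkOn.sum _ fun i _ => ?_⟩
    have h1 : IsCkOn k ((univ : Set (Fin n → ℝ)) ×ˢ (univ : Set (Fin n → ℝ)))
        (fun p => D (i :: w) p.1) := by
      have := (ih (i :: w)).comp_affine (U := univ ×ˢ univ)
        (ContinuousLinearMap.fst ℝ (Fin n → ℝ) (Fin n → ℝ)) 0 (fun _ _ => mem_univ _)
        (fun _ _ => by simp)
      simpa using this
    exact h1.smul_comp contDiff_id
      ((ContinuousLinearMap.proj i).comp (ContinuousLinearMap.snd ℝ (Fin n → ℝ) (Fin n → ℝ)))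

/-- The set of points whose coordinates in `J` are nonnegative. -/
def orthant (J : Finset (Fin n)) : Set (Fin n → ℝ) := {x | ∀ j ∈ J, 0 ≤ x j}

/-- Makes partial derivatives within the cube unique, also on its boundary: from any point one can
move along the `i`-th axis towards the farther face. -/
theorem zero_mem_closure_single_directions {x : Fin n → ℝ} (hx : x ∈ Icc (0 : Fin n → ℝ) 1)
    (i : Fin n) :
    (0 : ℝ) ∈ closure {h : ℝ | h ≠ 0 ∧ x + h • Pi.single i (1 : ℝ) ∈ Icc (0 : Fin n → ℝ) 1} := by
  have hmem : ∀ h : ℝ, 0 ≤ x i + h → x i + h ≤ 1 →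
      x + h • Pi.single i (1 : ℝ) ∈ Icc (0 : Fin n → ℝ) 1 := by
    intro h h0 h1
    constructor <;> intro j <;> rcases eq_or_ne j i with rfl | hj
    · simpa using h0
    · simpa [hj] using hx.1 j
    · simpa using h1
    · simpa [hj] using hx.2 j
  have h0 := hx.1 i
  have h1 := hx.2 i
  simp only [Pi.zero_apply, Pi.one_apply] at h0 h1
  rw [Metric.mem_closure_iff]
  intro ε hε
  have hδ : 0 < min (ε / 2) (1 / 2) := by positivity
  have hδ1 := min_le_left (ε / 2) (1 / 2)
  have hδ2 := min_le_right (ε / 2) (1 / 2)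
  rcases le_total (x i) (1 / 2) with hxi | hxi
  · refine ⟨min (ε / 2) (1 / 2), ⟨hδ.ne', hmem _ (by linarith) (by linarith)⟩, ?_⟩
    rw [dist_comm, Real.dist_0_eq_abs, abs_of_pos hδ]
    linarith
  · refine ⟨-min (ε / 2) (1 / 2), ⟨by linarith, hmem _ (by linarith) (by linarith)⟩, ?_⟩
    rw [dist_comm, Real.dist_0_eq_abs, abs_neg, abs_of_pos hδ]
    linarith

theorem IsPartialFamily.eq_zero [T2Space F] {D : List (Fin n) → (Fin n → ℝ) → F}
    (hD : IsPartialFamily (Icc 0 1) D) {r : ℝ} {j : Fin n}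
    (h0 : ∀ x ∈ Icc (0 : Fin n → ℝ) 1, r < x j → D [] x = 0) (w : List (Fin n)) :
    ∀ x ∈ Icc (0 : Fin n → ℝ) 1, r < x j → D w x = 0 := by
  induction w with
  | nil => exact h0
  | cons i w ih =>
    intro x hx hxj
    have hopen : {y : Fin n → ℝ | r < y j} ∈ 𝓝 x :=
      (isOpen_lt continuous_const (continuous_apply j)).mem_nhds hxj
    have h1 : HasDirDeriv (Icc 0 1) (D w) x (Pi.single i 1) 0 := by
      refine hasDirDeriv_zero.congr ?_ (ih x hx hxj)
      filter_upwards [eventually_add_smul_mem hopen (Pi.single i 1)] with h hh hS using ih _ hS hh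
    have := mem_closure_iff_nhdsWithin_neBot.1 (zero_mem_closure_single_directions hx i)
    exact tendsto_nhds_unique (hD.hasDirDeriv w i x hx) h1

/-- Extension by zero from the cube to the orthant. The open sets `∀ j, x j < 1` and `∃ j, 2 / 3 < x
j` cover everything; on the first the indicator is `D w` within the orthant, on the second it is
zero. -/
theorem IsPartialFamily.indicator {D : List (Fin n) → (Fin n → ℝ) → F}
    (hD : IsPartialFamily (Icc 0 1) D)
    (h0 : ∀ w, ∀ x ∈ Icc (0 : Fin n → ℝ) 1, ∀ j, 2 / 3 < x j → D w x = 0) :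
    IsPartialFamily (orthant Finset.univ) (fun w => (Icc (0 : Fin n → ℝ) 1).indicator (D w)) := by
  have hlt : ∀ x : Fin n → ℝ, (∀ j, x j < 1) → {y : Fin n → ℝ | ∀ j, y j < 1} ∈ 𝓝 x := by
    intro x hx
    have : IsOpen {y : Fin n → ℝ | ∀ j, y j < 1} := by
      simp only [ofPred_forall]
      exact isOpen_iInter_of_finite fun j => isOpen_lt (continuous_apply j) continuous_const
    exact this.mem_nhds hx
  have hmem : ∀ x ∈ orthant (Finset.univ : Finset (Fin n)), (∀ j, x j < 1) → x ∈ Icc 0 1 :=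
    fun x hx h => ⟨fun j => hx j (Finset.mem_univ j), fun j => (h j).le⟩
  have hgt : ∀ (x : Fin n → ℝ) j, 2 / 3 < x j → {y : Fin n → ℝ | 2 / 3 < y j} ∈ 𝓝 x :=
    fun x j hx => (isOpen_lt continuous_const (continuous_apply j)).mem_nhds hx
  have hzero : ∀ w (x : Fin n → ℝ) j, 2 / 3 < x j →
      (Icc (0 : Fin n → ℝ) 1).indicator (D w) x = 0 := by
    intro w x j hx
    by_cases hxI : x ∈ Icc (0 : Fin n → ℝ) 1
    · rw [indicator_of_mem hxI, h0 w x hxI j hx]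
    · exact indicator_of_notMem hxI _
  have hcases : ∀ x : Fin n → ℝ, (∀ j, x j < 1) ∨ ∃ j, 2 / 3 < x j := by
    intro x
    by_contra! h
    obtain ⟨⟨j, hj⟩, h⟩ := h
    linarith [h j]
  refine ⟨fun w x hx => ?_, fun w i x hx => ?_⟩
  · rcases hcases x with hx1 | ⟨j, hj⟩
    · have h1 : ContinuousWithinAt (D w) (Icc 0 1) x := hD.continuousOn w x (hmem x hx hx1)
      have h2 : orthant Finset.univ ∩ {y : Fin n → ℝ | ∀ j, y j < 1} ⊆ Icc 0 1 :=
        fun y hy => hmem y hy.1 hy.2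
      rw [← continuousWithinAt_inter (hlt x hx1)]
      exact (h1.mono h2).congr (fun y hy => indicator_of_mem (h2 hy) _)
        (indicator_of_mem (hmem x hx hx1) _)
    · refine ContinuousAt.continuousWithinAt
        ((continuousAt_const (y := (0 : F))).congr ?_)
      filter_upwards [hgt x j hj] with y hy using (hzero w y j hy).symm
  · rcases hcases x with hx1 | ⟨j, hj⟩
    · have hxI := hmem x hx hx1
      have hev := eventually_add_smul_mem (hlt x hx1) (Pi.single i 1)
      have h1 : HasDirDeriv (orthant Finset.univ) (D w) x (Pi.single i 1) (D (i :: w) x) := by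
        refine (hD.hasDirDeriv w i x hxI).of_eventually_mem ?_
        filter_upwards [hev] with h hh hS using hmem _ hS hh
      simp only [indicator_of_mem hxI]
      refine h1.congr ?_ (indicator_of_mem hxI _)
      filter_upwards [hev] with h hh hS using indicator_of_mem (hmem _ hS hh) _
    · simp only [hzero (i :: w) x j hj]
      refine hasDirDeriv_zero.congr ?_ (hzero w x j hj)
      filter_upwards [eventually_add_smul_mem (hgt x j hj) (Pi.single i 1)] with h hh hS
      exact hzero w _ j hh

end PartialFamily

/-! ### Seeley's reflection and its limit at the hyperplane. -/

section SeeleyExtension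

universe v

variable {F : Type v} [AddCommGroup F] [Module ℝ F] [TopologicalSpace F] {n : ℕ}

/-- Multiplication of the `i`-th coordinate by `b`. -/
def scaleCoord (i : Fin n) (b : ℝ) : (Fin n → ℝ) →L[ℝ] (Fin n → ℝ) :=
  ContinuousLinearMap.pi fun j => (if j = i then b else 1) • ContinuousLinearMap.proj j

theorem scaleCoord_apply (i : Fin n) (b : ℝ) (x : Fin n → ℝ) (j : Fin n) :
    scaleCoord i b x j = (if j = i then b else 1) * x j := rfl

theorem scaleCoord_single (i : Fin n) (b : ℝ) (j : Fin n) :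
    scaleCoord i b (Pi.single j 1) = (if j = i then b else 1 : ℝ) • Pi.single j (1 : ℝ) := by
  ext k
  rw [scaleCoord_apply, Pi.smul_apply, smul_eq_mul]
  rcases eq_or_ne k j with rfl | h
  · rfl
  · simp [h]

theorem scaleCoord_eq_self {i : Fin n} {x : Fin n → ℝ} (hx : x i = 0) (b : ℝ) :
    scaleCoord i b x = x := by
  ext j
  rw [scaleCoord_apply]
  split_ifs with h
  · rw [h, hx, mul_zero]
  · rw [one_mul]

/-- The weights of the derivative `D w` in Seeley's reflection in the `i`-th coordinate. -/
noncomputable def seeleyWeight (i : Fin n) (w : List (Fin n)) (k : ℕ) : ℝ :=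
  seeleyCoeff k * (-2 ^ k) ^ w.count i

theorem seeleyWeight_cons (i j : Fin n) (w : List (Fin n)) (k : ℕ) :
    seeleyWeight i (j :: w) k = seeleyWeight i w k * if j = i then -2 ^ k else 1 := by
  rw [seeleyWeight, seeleyWeight, List.count_cons]
  by_cases h : j = i
  · simp [h, pow_succ, mul_assoc]
  · simp [h]

/-- Seeley's reflection in the `i`-th coordinate. -/
noncomputable def seeleyReflection (i : Fin n) (D : List (Fin n) → (Fin n → ℝ) → F)
    (w : List (Fin n)) (x : Fin n → ℝ) : F :=
  ∑' k, seeleyWeight i w k • D w (scaleCoord i (-2 ^ k) x)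

/-- Seeley's extension across the hyperplane on which the `i`-th coordinate vanishes. -/
noncomputable def seeleyExtension (i : Fin n) (D : List (Fin n) → (Fin n → ℝ) → F)
    (w : List (Fin n)) (x : Fin n → ℝ) : F :=
  if 0 ≤ x i then D w x else seeleyReflection i D w x

variable {i : Fin n} {J : Finset (Fin n)} {D : List (Fin n) → (Fin n → ℝ) → F}

theorem scaleCoord_mem_orthant {x : Fin n → ℝ} (hx : x ∈ orthant J) (hxi : x i ≤ 0) (k : ℕ) :
    scaleCoord i (-2 ^ k) x ∈ orthant (insert i J) := by
  intro j hj
  rw [scaleCoord_apply]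
  split_ifs with h
  · rw [h, neg_mul, neg_nonneg]
    exact mul_nonpos_of_nonneg_of_nonpos (by positivity) hxi
  · rw [one_mul]
    exact hx j ((Finset.mem_insert.1 hj).resolve_left h)

/-- Away from the hyperplane, only finitely many terms of the reflection are nonzero. -/
theorem exists_seeleyReflection_eq_sum
    (hv : ∀ w, ∀ x ∈ orthant (insert i J), ∀ j ∈ insert i J, 1 ≤ x j → D w x = 0)
    {δ : ℝ} (hδ : 0 < δ) : ∃ K : ℕ, ∀ w, ∀ x ∈ orthant J, x i < -δ →
      seeleyReflection i D w x =
        ∑ k ∈ Finset.range K, seeleyWeight i w k • D w (scaleCoord i (-2 ^ k) x) ∧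
      HasSum (fun k => seeleyWeight i w k • D w (scaleCoord i (-2 ^ k) x))
        (seeleyReflection i D w x) := by
  -- For `k ≥ K` the reflected coordinate `-2 ^ k * x i` exceeds `1`, where `D w` vanishes.
  obtain ⟨K, hK⟩ := pow_unbounded_of_one_lt δ⁻¹ (one_lt_two (α := ℝ))
  refine ⟨K, fun w x hx hxi => ?_⟩
  have h0 : ∀ k ∉ Finset.range K, seeleyWeight i w k • D w (scaleCoord i (-2 ^ k) x) = 0 := by
    intro k hk
    rw [hv w _ (scaleCoord_mem_orthant hx (by linarith) k) i (Finset.mem_insert_self i J),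
      smul_zero]
    have h1 : (2 : ℝ) ^ K ≤ 2 ^ k := pow_le_pow_right₀ one_le_two (by simpa using hk)
    have h2 : δ⁻¹ * δ ≤ 2 ^ k * -x i :=
      mul_le_mul (hK.le.trans h1) (by linarith) hδ.le (by positivity)
    rw [inv_mul_cancel₀ hδ.ne'] at h2
    rw [scaleCoord_apply, if_pos rfl]
    linarith
  have h1 : HasSum (fun k => seeleyWeight i w k • D w (scaleCoord i (-2 ^ k) x)) _ :=
    hasSum_sum_of_ne_finset_zero h0
  have h2 : seeleyReflection i D w x = _ := tsum_eq_sum h0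
  exact ⟨h2, h2 ▸ h1⟩

theorem hasSum_seeleyWeight_smul [ContinuousSMul ℝ F] (w : List (Fin n)) (y : F) :
    HasSum (fun k => seeleyWeight i w k • y) y := by
  have h := (hasSum_seeleyCoeff_mul_neg_two_pow_pow (w.count i)).smul_const y
  rwa [one_smul] at h

/-- On the hyperplane every scaled point is `x` itself, so only the moment of order `w.count i`
enters, and it equals one. -/
theorem hasSum_seeleyReflection_of_eq_zero [ContinuousSMul ℝ F] [T2Space F] (w : List (Fin n))
    {x : Fin n → ℝ} (hxi : x i = 0) :
    HasSum (fun k => seeleyWeight i w k • D w (scaleCoord i (-2 ^ k) x)) (D w x) ∧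
      seeleyReflection i D w x = D w x := by
  have h := hasSum_seeleyWeight_smul (i := i) w (D w x)
  refine ⟨by simpa only [scaleCoord_eq_self hxi] using h, ?_⟩
  simpa only [seeleyReflection, scaleCoord_eq_self hxi] using h.tsum_eq

theorem hasSum_seeleyReflection [ContinuousSMul ℝ F] [T2Space F]
    (hv : ∀ w, ∀ x ∈ orthant (insert i J), ∀ j ∈ insert i J, 1 ≤ x j → D w x = 0)
    (w : List (Fin n)) {x : Fin n → ℝ} (hx : x ∈ orthant J) (hxi : x i ≤ 0) :
    HasSum (fun k => seeleyWeight i w k • D w (scaleCoord i (-2 ^ k) x))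
      (seeleyReflection i D w x) := by
  rcases hxi.lt_or_eq with h | h
  · obtain ⟨K, hK⟩ := exists_seeleyReflection_eq_sum hv (half_pos (neg_pos.2 h))
    exact (hK w x hx (by linarith)).2
  · obtain ⟨h1, h2⟩ := hasSum_seeleyReflection_of_eq_zero (D := D) w h
    rwa [h2]

theorem Seminorm.le_tsum_of_hasSum (p : Seminorm ℝ F) (hp : Continuous p) {u : ℕ → F} {y : F}
    (hu : HasSum u y) (hs : Summable fun k => p (u k)) : p y ≤ ∑' k, p (u k) := by
  refine le_of_tendsto ((hp.tendsto y).comp hu) (Eventually.of_forall fun s => ?_)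
  exact (Finset.le_sum_of_subadditive p (map_zero p).le (map_add_le_add p) s u).trans
    (hs.sum_le_tsum s fun k _ => apply_nonneg p _)

/-- Since the weights sum to one, `D w x` can be subtracted inside the sum; dominated convergence is
then applied to each continuous seminorm. -/
theorem tendsto_seeleyReflection [IsTopologicalAddGroup F] [ContinuousSMul ℝ F]
    [LocallyConvexSpace ℝ F] [T2Space F]
    (hD : IsPartialFamily (orthant (insert i J)) D)
    (hv : ∀ w, ∀ x ∈ orthant (insert i J), ∀ j ∈ insert i J, 1 ≤ x j → D w x = 0)
    (w : List (Fin n)) {x : Fin n → ℝ} (hx : x ∈ orthant J) (hxi : x i = 0) :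
    Tendsto (seeleyReflection i D w) (𝓝[orthant J ∩ {y | y i ≤ 0}] x) (𝓝 (D w x)) := by
  have hx' : x ∈ orthant (insert i J) := by
    intro j hj
    rcases Finset.mem_insert.1 hj with rfl | hj
    · exact hxi.ge
    · exact hx j hj
  rw [(with_gaugeSeminormFamily (𝕜 := ℝ) (E := F)).tendsto_nhds]
  intro s ε hε
  set p := gaugeSeminormFamily ℝ F s
  have hp : Continuous p := (with_gaugeSeminormFamily (𝕜 := ℝ) (E := F)).continuous_seminorm s
  set q : (Fin n → ℝ) → ℝ := fun y => p (D w y - D w x) with hq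
  have hqc : ContinuousOn q (orthant (insert i J)) :=
    hp.comp_continuousOn ((hD.continuousOn w).sub continuousOn_const)
  have hclosed : IsClosed (orthant (insert i J)) := by
    have : orthant (insert i J) = ⋂ j ∈ insert i J, {y : Fin n → ℝ | 0 ≤ y j} := by
      ext; simp [orthant]
    rw [this]
    exact isClosed_biInter fun j _ => isClosed_le continuous_const (continuous_apply j)
  have hcomp : IsCompact (Metric.closedBall x 1 ∩ orthant (insert i J)) :=
    (isCompact_closedBall x 1).inter_right hclosed
  obtain ⟨M₀, hM₀⟩ := hcomp.bddAbove_image (hqc.mono inter_subset_right)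
  -- A reflected point either has `i`-th coordinate at least `1`, where `D w` vanishes and `q`
  -- equals `p (D w x)`, or stays in a compact part of the orthant, where `q ≤ M₀`.
  set M := max M₀ (p (D w x))
  have hbound : ∀ y ∈ orthant J, y i ≤ 0 → y ∈ Metric.closedBall x 1 → ∀ k : ℕ,
      q (scaleCoord i (-2 ^ k) y) ≤ M := by
    intro y hy hyi hyb k
    have hm := scaleCoord_mem_orthant hy hyi k
    by_cases h1 : 1 ≤ scaleCoord i (-2 ^ k) y i
    · refine le_max_of_le_right ?_
      simp only [hq]
      rw [hv w _ hm i (Finset.mem_insert_self i J) h1, zero_sub, map_neg_eq_map]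
    · refine le_max_of_le_left (hM₀ ⟨_, ⟨?_, hm⟩, rfl⟩)
      rw [Metric.mem_closedBall, dist_pi_le_iff zero_le_one]
      intro j
      rcases eq_or_ne j i with rfl | hj
      · have h0 := hm j (Finset.mem_insert_self j J)
        rw [hxi, Real.dist_0_eq_abs, abs_of_nonneg h0]
        exact (not_le.1 h1).le
      · rw [scaleCoord_apply, if_neg hj, one_mul]
        exact (dist_le_pi_dist y x j).trans hyb
  have hsw : Summable fun k => |seeleyWeight i w k| :=
    (summable_seeleyCoeff_mul_neg_two_pow_pow (w.count i)).abs
  have hball : Metric.closedBall x 1 ∈ 𝓝[orthant J ∩ {y | y i ≤ 0}] x :=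
    nhdsWithin_le_nhds (Metric.closedBall_mem_nhds x one_pos)
  have hle : ∀ y ∈ orthant J, y i ≤ 0 → y ∈ Metric.closedBall x 1 →
      p (seeleyReflection i D w y - D w x) ≤
        ∑' k, |seeleyWeight i w k| * q (scaleCoord i (-2 ^ k) y) := by
    intro y hy hyi hyb
    have h1 := (hasSum_seeleyReflection hv w hy hyi).sub
      (hasSum_seeleyWeight_smul (i := i) w (D w x))
    have h2 : ∀ k, p (seeleyWeight i w k • D w (scaleCoord i (-2 ^ k) y) -
        seeleyWeight i w k • D w x) =
        |seeleyWeight i w k| * q (scaleCoord i (-2 ^ k) y) := fun k => by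
      rw [← smul_sub, map_smul_eq_mul, Real.norm_eq_abs]
    refine (p.le_tsum_of_hasSum hp h1 ?_).trans_eq (tsum_congr h2)
    simp only [h2]
    exact (hsw.mul_right M).of_nonneg_of_le
      (fun k => mul_nonneg (abs_nonneg _) (apply_nonneg p _))
      (fun k => mul_le_mul_of_nonneg_left (hbound y hy hyi hyb k) (abs_nonneg _))
  have hlim : Tendsto (fun y => ∑' k, |seeleyWeight i w k| * q (scaleCoord i (-2 ^ k) y))
      (𝓝[orthant J ∩ {y | y i ≤ 0}] x) (𝓝 (∑' _ : ℕ, (0 : ℝ))) := by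
    refine tendsto_tsum_of_dominated_convergence (hsw.mul_right M) (fun k => ?_) ?_
    · have h1 : Tendsto (scaleCoord i (-2 ^ k)) (𝓝[orthant J ∩ {y | y i ≤ 0}] x)
          (𝓝[orthant (insert i J)] x) := by
        refine tendsto_nhdsWithin_of_tendsto_nhds_of_eventually_within _ ?_ ?_
        · exact Tendsto.mono_left ((scaleCoord i (-2 ^ k)).continuous.tendsto' _ _
            (scaleCoord_eq_self hxi _)) nhdsWithin_le_nhds
        · filter_upwards [self_mem_nhdsWithin] with y hy using scaleCoord_mem_orthant hy.1 hy.2 k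
      have h2 := ((hqc x hx').tendsto.comp h1).const_mul |seeleyWeight i w k|
      simpa [hq] using h2
    · filter_upwards [self_mem_nhdsWithin, hball] with y hy hyb k
      rw [Real.norm_of_nonneg (mul_nonneg (abs_nonneg _) (apply_nonneg p _))]
      exact mul_le_mul_of_nonneg_left (hbound y hy.1 hy.2 hyb k) (abs_nonneg _)
  rw [tsum_zero] at hlim
  filter_upwards [hlim.eventually_lt_const hε, self_mem_nhdsWithin, hball] with y h1 hy hyb
  exact (hle y hy.1 hy.2 hyb).trans_lt h1

end SeeleyExtension

/-! ### The extended maps again form a partial derivative family. -/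

section SeeleyFamily

universe v

variable {F : Type v} [AddCommGroup F] [Module ℝ F] [TopologicalSpace F] {n : ℕ}
  {i : Fin n} {J : Finset (Fin n)} {D : List (Fin n) → (Fin n → ℝ) → F}

theorem mem_orthant_insert {x : Fin n → ℝ} :
    x ∈ orthant (insert i J) ↔ 0 ≤ x i ∧ x ∈ orthant J := by
  simp [orthant]

theorem add_smul_single_mem_orthant {x : Fin n → ℝ} (hx : x ∈ orthant J) (hi : i ∉ J) (h : ℝ) :
    x + h • Pi.single i (1 : ℝ) ∈ orthant J := by
  intro j hj
  have : j ≠ i := fun hji => hi (hji ▸ hj)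
  simpa [this] using hx j hj

theorem seeleyExtension_eqOn (w : List (Fin n)) :
    EqOn (seeleyExtension i D w) (D w) (orthant (insert i J)) := fun _ hx =>
  if_pos (mem_orthant_insert.1 hx).1

theorem seeleyExtension_eqOn_reflection [ContinuousSMul ℝ F] [T2Space F] (w : List (Fin n)) :
    EqOn (seeleyExtension i D w) (seeleyReflection i D w) {x | x i ≤ 0} := by
  intro x hx
  rcases (show x i ≤ 0 from hx).lt_or_eq with h | h
  · exact if_neg (not_le.2 h)
  · rw [(hasSum_seeleyReflection_of_eq_zero w h).2]
    exact if_pos h.ge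

theorem exists_seeleyExtension_eq_sum
    (hv : ∀ w, ∀ x ∈ orthant (insert i J), ∀ j ∈ insert i J, 1 ≤ x j → D w x = 0)
    {x : Fin n → ℝ} (hxi : x i < 0) : ∃ K : ℕ, ∃ V ∈ 𝓝 x, (∀ y ∈ V, y i ≤ 0) ∧
      ∀ w, ∀ y ∈ orthant J ∩ V, seeleyExtension i D w y =
        ∑ k ∈ Finset.range K, seeleyWeight i w k • D w (scaleCoord i (-2 ^ k) y) := by
  -- Half the distance to the hyperplane leaves a neighbourhood of `x` on which one `K` serves all
  -- points and all words.
  obtain ⟨K, hK⟩ := exists_seeleyReflection_eq_sum hv (half_pos (neg_pos.2 hxi))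
  refine ⟨K, {y | y i < -(-x i / 2)}, ?_, ?_, ?_⟩
  · exact (isOpen_lt (continuous_apply i) continuous_const).mem_nhds
      (by simp only [mem_ofPred_eq]; linarith)
  · intro y (hy : y i < _)
    linarith
  · rintro w y ⟨hy, hyi : y i < _⟩
    rw [← (hK w y hy hyi).1]
    exact if_neg (by linarith)

theorem continuousOn_seeleyExtension [IsTopologicalAddGroup F] [ContinuousSMul ℝ F]
    [LocallyConvexSpace ℝ F] [T2Space F]
    (hD : IsPartialFamily (orthant (insert i J)) D)
    (hv : ∀ w, ∀ x ∈ orthant (insert i J), ∀ j ∈ insert i J, 1 ≤ x j → D w x = 0)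
    (w : List (Fin n)) : ContinuousOn (seeleyExtension i D w) (orthant J) := by
  intro x hx
  have hright : 0 ≤ x i → ContinuousWithinAt (seeleyExtension i D w) (orthant (insert i J)) x :=
    fun hxi => (hD.continuousOn w).congr (seeleyExtension_eqOn w) x
      (mem_orthant_insert.2 ⟨hxi, hx⟩)
  rcases lt_trichotomy (x i) 0 with hxi | hxi | hxi
  · obtain ⟨K, V, hV, hVi, hK⟩ := exists_seeleyExtension_eq_sum hv hxi
    rw [← continuousWithinAt_inter hV]
    refine ContinuousOn.congr (continuousOn_finsetSum _ fun k _ => ?_) (hK w) x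
      ⟨hx, mem_of_mem_nhds hV⟩
    exact ((hD.continuousOn w).comp (scaleCoord i (-2 ^ k)).continuous.continuousOn
      fun y hy => scaleCoord_mem_orthant hy.1 (hVi y hy.2) k).const_smul _
  · have hleft : ContinuousWithinAt (seeleyExtension i D w) (orthant J ∩ {y | y i ≤ 0}) x := by
      have h1 := tendsto_seeleyReflection hD hv w hx hxi
      rw [← (hasSum_seeleyReflection_of_eq_zero (D := D) w hxi).2] at h1
      exact ContinuousWithinAt.congr h1
        (fun y hy => seeleyExtension_eqOn_reflection w hy.2)
        (seeleyExtension_eqOn_reflection w hxi.le)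
    refine ((hright hxi.ge).union hleft).mono fun y hy => ?_
    rcases le_total 0 (y i) with h | h
    · exact Or.inl (mem_orthant_insert.2 ⟨h, hy⟩)
    · exact Or.inr ⟨hy, h⟩
  · have hV : {y : Fin n → ℝ | 0 < y i} ∈ 𝓝 x :=
      (isOpen_lt continuous_const (continuous_apply i)).mem_nhds hxi
    rw [← continuousWithinAt_inter hV]
    exact (hright hxi.le).mono fun y hy => mem_orthant_insert.2 ⟨le_of_lt hy.2, hy.1⟩

theorem hasDirDeriv_seeleyExtension_of_neg [IsTopologicalAddGroup F] [ContinuousSMul ℝ F]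
    (hD : IsPartialFamily (orthant (insert i J)) D)
    (hv : ∀ w, ∀ x ∈ orthant (insert i J), ∀ j ∈ insert i J, 1 ≤ x j → D w x = 0)
    (w : List (Fin n)) (j : Fin n) {x : Fin n → ℝ} (hx : x ∈ orthant J) (hxi : x i < 0) :
    HasDirDeriv (orthant J) (seeleyExtension i D w) x (Pi.single j 1)
      (seeleyExtension i D (j :: w) x) := by
  obtain ⟨K, V, hV, hVi, hK⟩ := exists_seeleyExtension_eq_sum hv hxi
  have hxV := mem_of_mem_nhds hV
  have hterm : ∀ k, HasDirDeriv (orthant J ∩ {y | y i ≤ 0})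
      (fun y => seeleyWeight i w k • D w (scaleCoord i (-2 ^ k) y)) x (Pi.single j 1)
      (seeleyWeight i (j :: w) k • D (j :: w) (scaleCoord i (-2 ^ k) x)) := by
    intro k
    have hb : (if j = i then -2 ^ k else 1 : ℝ) ≠ 0 := by
      split_ifs
      · exact neg_ne_zero.2 (pow_ne_zero _ two_ne_zero)
      · exact one_ne_zero
    have h1 := (hD.hasDirDeriv w j _ (scaleCoord_mem_orthant hx hxi.le k)).smul_direction hb
    rw [← scaleCoord_single] at h1
    have h2 := (HasDirDeriv.comp_linear (S := orthant J ∩ {y | y i ≤ 0})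
      (f := D w) (x := x) (v := Pi.single j 1)
      (scaleCoord i (-2 ^ k) : (Fin n → ℝ) →ₗ[ℝ] (Fin n → ℝ)) 0
      (fun y hy => by simpa using scaleCoord_mem_orthant hy.1 hy.2 k)
      (by simpa using h1)).const_smul (seeleyWeight i w k)
    rw [seeleyWeight_cons, mul_smul]
    simpa using h2
  rw [hK (j :: w) x ⟨hx, hxV⟩]
  have hev := eventually_add_smul_mem hV (Pi.single j 1)
  refine ((HasDirDeriv.sum (Finset.range K) fun k _ => hterm k).of_eventually_mem
    (S := orthant J) ?_).congr ?_ (hK w x ⟨hx, hxV⟩)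
  · filter_upwards [hev] with h hh hS using ⟨hS, hVi _ hh⟩
  · filter_upwards [hev] with h hh hS using hK w _ ⟨hS, hh⟩

/-- No termwise differentiation at the hyperplane: the derivative is known strictly to the left and
tends to `seeleyExtension i D (i :: w) x`, so the mean value theorem gives the one-sided derivative.
-/
theorem hasDirDeriv_seeleyExtension_left [IsTopologicalAddGroup F] [ContinuousSMul ℝ F]
    [LocallyConvexSpace ℝ F] [T2Space F] (hi : i ∉ J)
    (hD : IsPartialFamily (orthant (insert i J)) D)
    (hv : ∀ w, ∀ x ∈ orthant (insert i J), ∀ j ∈ insert i J, 1 ≤ x j → D w x = 0)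
    (w : List (Fin n)) {x : Fin n → ℝ} (hx : x ∈ orthant J) (hxi : x i = 0) :
    HasDirDeriv (orthant J ∩ {y | y i ≤ 0}) (seeleyExtension i D w) x (Pi.single i 1)
      (seeleyExtension i D (i :: w) x) := by
  intro W hW
  obtain ⟨C, hC, hCc, hCcl, hCW⟩ := exists_closed_convex_nhds_subset hW
  obtain ⟨ε, hε, hball⟩ := Metric.mem_nhdsWithin_iff.1
    (continuousOn_seeleyExtension hD hv (i :: w) x hx hC)
  have hsmall := (nhdsWithin_le_nhds
      (s := {h : ℝ | h ≠ 0 ∧ x + h • Pi.single i (1 : ℝ) ∈ orthant J ∩ {y | y i ≤ 0}}))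
    (eventually_add_smul_mem (Metric.ball_mem_nhds x hε) (Pi.single i 1))
  rw [mem_map]
  filter_upwards [self_mem_nhdsWithin, hsmall] with h hh hhε
  have hneg : h < 0 := by
    have : (x + h • Pi.single i (1 : ℝ) : Fin n → ℝ) i ≤ 0 := hh.2.2
    simp only [Pi.add_apply, Pi.smul_apply, Pi.single_eq_same, hxi, zero_add, smul_eq_mul,
      mul_one] at this
    exact lt_of_le_of_ne this hh.1
  refine hCW (slope_mem_of_hasDirDeriv hh.1 hCc hCcl ?_ fun s hs => ?_)
  · exact (continuousOn_seeleyExtension hD hv w).comp (by fun_prop)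
      fun s _ => add_smul_single_mem_orthant hx hi _
  · have hmem := add_smul_single_mem_orthant hx hi (s * h)
    refine ⟨seeleyExtension i D (i :: w) (x + (s * h) • Pi.single i 1), hball ⟨?_, hmem⟩, ?_⟩
    · rw [mul_smul]
      exact (convex_ball x ε).add_smul_mem (Metric.mem_ball_self hε) hhε (Ioo_subset_Icc_self hs)
    · have hlt : (x + (s * h) • Pi.single i (1 : ℝ) : Fin n → ℝ) i < 0 := by
        simpa [hxi] using mul_neg_of_pos_of_neg hs.1 hneg
      exact (hasDirDeriv_seeleyExtension_of_neg hD hv w i hmem hlt).of_eventually_mem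
        (Eventually.of_forall fun t _ => add_smul_single_mem_orthant hmem hi t)

theorem IsPartialFamily.seeleyExtension [IsTopologicalAddGroup F] [ContinuousSMul ℝ F]
    [LocallyConvexSpace ℝ F] [T2Space F] (hi : i ∉ J)
    (hD : IsPartialFamily (orthant (insert i J)) D)
    (hv : ∀ w, ∀ x ∈ orthant (insert i J), ∀ j ∈ insert i J, 1 ≤ x j → D w x = 0) :
    IsPartialFamily (orthant J) (seeleyExtension i D) := by
  refine ⟨continuousOn_seeleyExtension hD hv, fun w j x hx => ?_⟩
  rcases lt_or_ge (x i) 0 with hxi | hxi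
  · exact hasDirDeriv_seeleyExtension_of_neg hD hv w j hx hxi
  have hx' : x ∈ orthant (insert i J) := mem_orthant_insert.2 ⟨hxi, hx⟩
  have hright : HasDirDeriv (orthant (insert i J)) (_root_.seeleyExtension i D w) x
      (Pi.single j 1) (_root_.seeleyExtension i D (j :: w) x) := by
    rw [seeleyExtension_eqOn (j :: w) hx']
    exact (hD.hasDirDeriv w j x hx').congr
      (Eventually.of_forall fun h hh => seeleyExtension_eqOn w hh) (seeleyExtension_eqOn w hx')
  -- Only a line crossing the hyperplane at `x` sees both sides; every other one stays locally in `x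
  -- i ≥ 0`.
  by_cases hji : j = i ∧ x i = 0
  · obtain ⟨rfl, hxi⟩ := hji
    refine (hright.union (hasDirDeriv_seeleyExtension_left hi hD hv w hx hxi)).mono fun y hy => ?_
    rcases le_total 0 (y j) with h | h
    · exact Or.inl (mem_orthant_insert.2 ⟨h, hy⟩)
    · exact Or.inr ⟨hy, h⟩
  · refine hright.of_eventually_mem ?_
    have hev : ∀ᶠ h : ℝ in 𝓝 0, 0 ≤ (x + h • Pi.single j (1 : ℝ) : Fin n → ℝ) i := by
      rcases eq_or_ne i j with rfl | hij
      · have hpos : 0 < x i := lt_of_le_of_ne hxi fun h => hji ⟨rfl, h.symm⟩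
        have hV : {y : Fin n → ℝ | 0 < y i} ∈ 𝓝 x :=
          (isOpen_lt continuous_const (continuous_apply i)).mem_nhds hpos
        exact (eventually_add_smul_mem hV _).mono fun h hh => le_of_lt hh
      · exact Eventually.of_forall fun h => by simpa [hij] using hxi
    filter_upwards [hev] with h hh hS using mem_orthant_insert.2 ⟨hh, hS⟩

/-- Reflection in coordinate `i` leaves the others alone, so the vanishing needed for the remaining
reflections survives. -/
theorem seeleyExtension_eq_zero
    (hv : ∀ w, ∀ x ∈ orthant (insert i J), ∀ j ∈ insert i J, 1 ≤ x j → D w x = 0) (hi : i ∉ J)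
    (w : List (Fin n)) : ∀ x ∈ orthant J, ∀ j ∈ J, 1 ≤ x j → seeleyExtension i D w x = 0 := by
  intro x hx j hj hxj
  have hji : j ≠ i := fun h => hi (h ▸ hj)
  rw [seeleyExtension]
  split_ifs with hxi
  · exact hv w x (mem_orthant_insert.2 ⟨hxi, hx⟩) j (Finset.mem_insert_of_mem hj) hxj
  · rw [seeleyReflection]
    refine (tsum_congr fun k => ?_).trans tsum_zero
    rw [hv w _ (scaleCoord_mem_orthant hx (not_le.1 hxi).le k) j (Finset.mem_insert_of_mem hj),
      smul_zero]
    rwa [scaleCoord_apply, if_neg hji, one_mul]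

theorem IsPartialFamily.exists_extension [IsTopologicalAddGroup F] [ContinuousSMul ℝ F]
    [LocallyConvexSpace ℝ F] [T2Space F] (J : Finset (Fin n))
    (hD : IsPartialFamily (orthant J) D)
    (hv : ∀ w, ∀ x ∈ orthant J, ∀ j ∈ J, 1 ≤ x j → D w x = 0) :
    ∃ G, IsPartialFamily univ G ∧ ∀ w, EqOn (G w) (D w) (orthant J) := by
  induction J using Finset.induction_on generalizing D with
  | empty =>
    have : orthant (∅ : Finset (Fin n)) = univ := by ext; simp [orthant]
    exact ⟨D, this ▸ hD, fun w x _ => rfl⟩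
  | insert i J hi ih =>
    obtain ⟨G, hG, hGD⟩ := ih (hD.seeleyExtension hi hv) (seeleyExtension_eq_zero hv hi)
    refine ⟨G, hG, fun w x hx => ?_⟩
    rw [hGD w (mem_orthant_insert.1 hx).2, seeleyExtension_eqOn w hx]

end SeeleyFamily

/-! ### Cutting the cube into corner pieces. -/

section Cube

universe v

variable {F : Type v} [AddCommGroup F] [Module ℝ F] [TopologicalSpace F] {n : ℕ}

theorem nonempty_interior_Icc_zero_one : (interior (Icc (0 : Fin n → ℝ) 1)).Nonempty := by
  rw [← pi_univ_Icc, interior_pi_set finite_univ]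
  refine ⟨fun _ => 1 / 2, fun j _ => ?_⟩
  simp only [Pi.zero_apply, Pi.one_apply, interior_Icc]
  norm_num

/-- The reflection of the cube in the `i`-th coordinate. -/
def flipCoord (i : Fin n) (x : Fin n → ℝ) : Fin n → ℝ := scaleCoord i (-1) x + Pi.single i 1

theorem flipCoord_same (i : Fin n) (x : Fin n → ℝ) : flipCoord i x i = 1 - x i := by
  rw [flipCoord, Pi.add_apply, scaleCoord_apply, if_pos rfl, Pi.single_eq_same]
  ring

theorem flipCoord_of_ne {i j : Fin n} (h : j ≠ i) (x : Fin n → ℝ) : flipCoord i x j = x j := by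
  rw [flipCoord, Pi.add_apply, scaleCoord_apply, if_neg h, Pi.single_eq_of_ne h]
  ring

theorem flipCoord_flipCoord (i : Fin n) (x : Fin n → ℝ) : flipCoord i (flipCoord i x) = x := by
  ext j
  rcases eq_or_ne j i with rfl | h
  · simp [flipCoord_same]
  · simp [flipCoord_of_ne h]

theorem flipCoord_mem_Icc {i : Fin n} {x : Fin n → ℝ} (hx : x ∈ Icc (0 : Fin n → ℝ) 1) :
    flipCoord i x ∈ Icc (0 : Fin n → ℝ) 1 := by
  constructor <;> intro j <;> have h0 := hx.1 j <;> have h1 := hx.2 j <;>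
    simp only [Pi.zero_apply, Pi.one_apply] at h0 h1 ⊢ <;> rcases eq_or_ne j i with rfl | h
  · rw [flipCoord_same]; linarith
  · rwa [flipCoord_of_ne h]
  · rw [flipCoord_same]; linarith
  · rwa [flipCoord_of_ne h]

theorem IsSmoothOn.comp_flipCoord {f : (Fin n → ℝ) → F} {U : Set (Fin n → ℝ)}
    (hf : IsSmoothOn U f) (i : Fin n) (hU : ∀ x ∈ U, flipCoord i x ∈ U) :
    IsSmoothOn U (fun x => f (flipCoord i x)) := by
  refine hf.comp_affine (scaleCoord i (-1)) (Pi.single i 1) hU fun x hx => ?_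
  change flipCoord i x ∈ interior U
  rw [mem_interior_iff_mem_nhds] at hx ⊢
  have hc : Continuous (flipCoord i) := (scaleCoord i (-1)).continuous.add continuous_const
  rw [← flipCoord_flipCoord i x] at hx
  filter_upwards [hc.continuousAt.preimage_mem_nhds hx] with y hy
  simpa only [flipCoord_flipCoord] using hU _ hy

variable [IsTopologicalAddGroup F] [ContinuousSMul ℝ F] [LocallyConvexSpace ℝ F] [T2Space F]

/-- Extension of smooth maps on the cube vanishing near the faces opposite to the origin. -/
theorem IsSmoothOn.exists_extension_of_eq_zero {f : (Fin n → ℝ) → F}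
    (hf : IsSmoothOn (Icc (0 : Fin n → ℝ) 1) f)
    (h0 : ∀ j, ∀ x ∈ Icc (0 : Fin n → ℝ) 1, 2 / 3 ≤ x j → f x = 0) :
    ∃ g : (Fin n → ℝ) → F, IsSmoothOn univ g ∧ EqOn g f (Icc 0 1) := by
  obtain ⟨D, rfl, hD⟩ := hf.exists_partialFamily (convex_Icc 0 1) nonempty_interior_Icc_zero_one
  have hv : ∀ w, ∀ x ∈ Icc (0 : Fin n → ℝ) 1, ∀ j, 2 / 3 < x j → D w x = 0 := fun w x hx j hj =>
    hD.eq_zero (fun y hy hyj => h0 j y hy hyj.le) w x hx hj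
  obtain ⟨G, hG, hGD⟩ := (hD.indicator hv).exists_extension Finset.univ fun w x _ j _ hxj => by
    by_cases hxI : x ∈ Icc (0 : Fin n → ℝ) 1
    · rw [indicator_of_mem hxI, hv w x hxI j (by linarith)]
    · exact indicator_of_notMem hxI _
  refine ⟨G [], hG.isSmoothOn [], fun x hx => ?_⟩
  rw [hGD [] fun j _ => hx.1 j, indicator_of_mem hx]

/-- `K` collects the coordinates whose far face is not yet cleared. Each step writes `f = (1 - ψ (x
i)) • f + ψ (x i) • f` and clears coordinate `i` in both summands, flipping it in the second. -/
theorem IsSmoothOn.exists_extension {f : (Fin n → ℝ) → F}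
    (hf : IsSmoothOn (Icc (0 : Fin n → ℝ) 1) f) (K : Finset (Fin n))
    (h0 : ∀ j ∉ K, ∀ x ∈ Icc (0 : Fin n → ℝ) 1, 2 / 3 ≤ x j → f x = 0) :
    ∃ g : (Fin n → ℝ) → F, IsSmoothOn univ g ∧ EqOn g f (Icc 0 1) := by
  induction K using Finset.induction_on generalizing f with
  | empty => exact hf.exists_extension_of_eq_zero fun j => h0 j (Finset.notMem_empty j)
  | insert i K hi ih =>
    set ψ : ℝ → ℝ := fun t => Real.smoothTransition (3 * t - 1)
    have hψ : ContDiff ℝ (↑(⊤ : ℕ∞)) ψ := Real.smoothTransition.contDiff.comp (by fun_prop)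
    have hψ0 : ∀ t ≤ 1 / 3, ψ t = 0 := fun t ht =>
      Real.smoothTransition.zero_of_nonpos (by linarith)
    have hψ1 : ∀ t, 2 / 3 ≤ t → ψ t = 1 := fun t ht =>
      Real.smoothTransition.one_of_one_le (by linarith)
    have hjK : ∀ j ∉ K, j ≠ i → j ∉ insert i K := fun j hj hji =>
      Finset.mem_insert.not.2 (not_or.2 ⟨hji, hj⟩)
    obtain ⟨g₁, hg₁, hg₁f⟩ := ih (hf.smul_comp (φ := fun t => 1 - ψ t) (contDiff_const.sub hψ)
      (ContinuousLinearMap.proj i)) (by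
        intro j hj x hx hxj
        rcases eq_or_ne j i with rfl | hji
        · simp [hψ1 _ hxj]
        · simp [h0 j (hjK j hj hji) x hx hxj])
    -- This summand vanishes for `x i ≤ 1 / 3`, hence after the flip for `x i ≥ 2 / 3`; flipping its
    -- extension back undoes the change of coordinate.
    obtain ⟨g₂, hg₂, hg₂f⟩ := ih ((hf.smul_comp hψ (ContinuousLinearMap.proj i)).comp_flipCoord i
      fun x => flipCoord_mem_Icc) (by
        intro j hj x hx hxj
        rcases eq_or_ne j i with rfl | hji
        · simp [flipCoord_same, hψ0 (1 - x j) (by linarith)]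
        · have := h0 j (hjK j hj hji) _ (flipCoord_mem_Icc (i := i) hx)
            (by rwa [flipCoord_of_ne hji])
          simp [this])
    refine ⟨_, hg₁.add (hg₂.comp_flipCoord i fun x _ => mem_univ _), fun x hx => ?_⟩
    simp only [hg₁f hx, hg₂f (flipCoord_mem_Icc (i := i) hx), flipCoord_flipCoord,
      ContinuousLinearMap.proj_apply]
    rw [← add_smul, sub_add_cancel, one_smul]

end Cube

theorem mainTheorem2 {F : Type*} [AddCommGroup F] [Module ℝ F] [UniformSpace F]
    [IsUniformAddGroup F] [ContinuousSMul ℝ F] [LocallyConvexSpace ℝ F]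
    [TopologicalSpace.MetrizableSpace F] [CompleteSpace F]
    (n : ℕ) (f : (Fin n → ℝ) → F) (hf : IsSmoothOn (Set.Icc (0 : Fin n → ℝ) 1) f) :
    ∃ g : (Fin n → ℝ) → F, IsSmoothOn Set.univ g ∧ Set.EqOn g f (Set.Icc 0 1) :=
  hf.exists_extension Finset.univ fun j hj => absurd (Finset.mem_univ j) hj
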